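/- **Setting.** Let $\Sigma=\mathbb R^3$ with coordinates $x^1,x^2,x^3$. Let $H^1(\Sigma)$ be the Sobolev space of vector fields (one-forms) $a=(a_k)$ with its usual Hilbert norm. Let $\mathcal H(\mathrm{div}0,\Sigma)\subset L^2(\Sigma)^3$ be the space of fields $p=(p^k)$ with $\partial_kp^k=0$ weakly, and put $H^1(\mathrm{div}0,\Sigma)=H^1(\Sigma)\cap \mathcal H(\mathrm{div}0,\Sigma)$. Let $K\subset H^1(\Sigma)$ be the closure in $H^1(\Sigma)$ of $\mathrm{grad}\,H^2(\Sigma)$, with topological dual $K^*$. The final constraint manifold of free electrodynamics is $M_\infty=H^1(\Sigma)\times\mathcal H(\mathrm{div}0,\Sigma)\ni(a,p)$ with $$\Omega_\infty(X,Y)=\int_\Sigma \big(X_{a_k}Y_p^k-X_p^kY_{a_k}\big)\,d^3x ,$$ and its coisotropic extension is $P=H^1(\mathrm{div}0,\Sigma)\times K\times\mathcal H(\mathrm{div}0,\Sigma)\times K^*\ni(\tilde a,\partial\phi,p,\mu)$ with $$\Omega^P(X,Y)=\int_\Sigma \big(X_{\tilde a_k}Y_p^k-X_p^kY_{\tilde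 a_k}\big)\,d^3x+\varepsilon\big(\langle Y_\mu,X_{\partial\phi}\rangle-\langle X_\mu,Y_{\partial\phi}\rangle\big),$$ where $\varepsilon\in\{1,-1\}$ is a fixed sign convention for the canonical form on $K\times K^*$. A rotation $R\in SO(3)$ acts on $M_\infty$ by $(a,p)\mapsto(R\,a(R^{-1}\cdot),R\,p(R^{-1}\cdot))$, in the same way on $\tilde a,\partial\phi,p$, and on $K^*$ by the dual action $\mu\mapsto\mu\circ R^{-1}$. For such a linear action on $V$ (with $V=M_\infty$ or $V=P$) let $D\subset V$ be the set of points whose orbit map $\theta\mapsto \exp(\theta\xi)\cdot m$ is differentiable at $0$ for every $\xi\in\mathfrak{so}(3)$, and for $m\in D$ let $X_\xi(m)=\frac{d}{d\theta}\big|_0\exp(\theta\xi)\cdot m$. The action is called Hamiltonian with momentum map $\mathbb J:D\to\mathfrak{so}(3)^*$ if it is a strongly continuous action preserving the two-form $\Omega$, $D$ is dense, and $dJ_\xi=\Omega(X_\xi,\cdot)$ on $D$ for every $\xi$, with $J_\xi=\langle\mathbb J,\xi\rangle$ and $d$ the Fréchet differential along $D$ for the graph norm $\|Y\|+\|X_\xi(Y)\|$.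 **Statement.** 1. $H^1(\Sigma)=H^1(\mathrm{div}0,\Sigma)\oplus K$, and the kernel of $\Omega_\infty$ is $K\times\{0\}$. The form $\Omega^P$ is (weakly) nondegenerate; the map $(\tilde a,\partial\phi,p,\mu)\mapsto(\tilde a+\partial\phi,p)$ identifies $\{\mu=0\}\subset P$ with $M_\infty$; under it $\Omega^P$ restricts to $\Omega_\infty$, and $\{\mu=0\}$ is coisotropic in $P$. This map $P\to M_\infty$ is $SO(3)$-equivariant. 2. The $SO(3)$-action on $(P,\Omega^P)$ is Hamiltonian. In the basis $\xi_jv=e_j\times v$ of $\mathfrak{so}(3)$ the components of its momentum map $\mathbb J_P$ are, with $L_1=x^3\partial_2-x^2\partial_3$, $L_2=x^1\partial_3-x^3\partial_1$, $L_3=x^2\partial_1-x^1\partial_2$, $$J_{\xi_j}(\tilde a,\partial\phi,p,\mu)=\int_\Sigma \sum_i(\mathcal L_j\tilde a)_i\,p^i\,d^3x+\varepsilon\,\langle\mu,\mathcal L_j\partial\phi\rangle ,$$ $$\mathcal L_1b=(L_1b_1,\;L_1b_2-b_3,\;L_1b_3+b_2),\quad \mathcal L_2b=(L_2b_1+b_3,\;L_2b_2,\;L_2b_3-b_1),\quad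 \mathcal L_3b=(L_3b_1-b_2,\;L_3b_2+b_1,\;L_3b_3);$$ on $D$ the integrand is integrable and $\mathcal L_j\partial\phi\in K$. 3. Let $\mathcal R$ be the Coulomb connection on $M_\infty$, i.e. the projection of tangent vectors $X=(X_a,X_p)$ onto $H^1(\mathrm{div}0,\Sigma)\times\mathcal H(\mathrm{div}0,\Sigma)$ along $K\times\{0\}$, and $\mathcal R^\uparrow$ its extension to $P$, $X\oplus\kappa\mapsto\mathcal R(X)\oplus\kappa$. Let $A_m(\xi)\in K$ be the vertical part $(\mathrm{id}-\mathcal R)X_\xi(m)$ of the generator on $M_\infty$. The action on $(M_\infty,\Omega_\infty)$ is Hamiltonian with a momentum map $\mathbb J$ whose components are the angular momentum charges of item 4, and on $D$ $$\langle\mathbb J_P(m,\mu),\xi\rangle=\langle\mathbb J(m),\xi\rangle+\varepsilon\,\langle\mu,A_m(\xi)\rangle .$$ 4. At the points of $D$ with $\mu=0$, with $a=\tilde a+\partial\phi$ and electric field $E=-p$, the currents are the standard angular momentum charges of the electromagnetic field: $$J_{\xi_1}=\int_\Sigma M^{023}d^3x,\quad J_{\xi_2}=\int_\Sigma M^{031}d^3x,\quad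 J_{\xi_3}=\int_\Sigma M^{012}d^3x,$$ where $M^{0kl}=x^kT^{0l}-x^lT^{0k}+E^ka_l-E^la_k$ and $T^{0l}=\sum_iE^i\partial_la_i$; the densities are integrable. -/

import Mathlib

open MeasureTheory Filter Topology
open scoped ContDiff RealInnerProductSpace

noncomputable section

namespace Maxwell

/-! ### Function spaces on the Cauchy surface -/

/-- The Cauchy surface `Σ = ℝ³` (and the space of values of vector fields on it).
Coordinates `x¹, x², x³` are `x 0, x 1, x 2`. -/
abbrev E3 : Type := EuclideanSpace ℝ (Fin 3)

/-- Square integrable functions on `Σ` with values in `F`. -/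
abbrev L2 (F : Type) [NormedAddCommGroup F] : Type := Lp F 2 (volume : Measure E3)

/-- The coordinate vector `∂_j`. -/
def basisVec (j : Fin 3) : E3 := EuclideanSpace.single j (1 : ℝ)

/-- Smooth compactly supported real functions on `Σ`. -/
def IsTest (ψ : E3 → ℝ) : Prop := ContDiff ℝ ∞ ψ ∧ HasCompactSupport ψ

/-- `g = ∂_j f` in the weak sense. -/
def IsWeakPartial {F : Type} [NormedAddCommGroup F] [NormedSpace ℝ F]
    (j : Fin 3) (f g : E3 → F) : Prop :=
  ∀ ψ : E3 → ℝ, IsTest ψ →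
    ∫ x, (fderiv ℝ ψ x (basisVec j)) • f x = - ∫ x, ψ x • g x

/-- The Hilbert space of `(a, ∂₁ a, ∂₂ a, ∂₃ a)`'s, without any relation between the four entries.
The entry `none` is the field, the entry `some j` is reserved for its `j`-th derivative. -/
abbrev Jet : Type := PiLp 2 (fun _ : Option (Fin 3) => L2 E3)

section Integrability

variable {F : Type} [NormedAddCommGroup F]

lemma IsTest.continuous_partial {ψ : E3 → ℝ} (hψ : IsTest ψ) (v : E3) :
    Continuous (fun x => fderiv ℝ ψ x v) :=
  (hψ.1.continuous_fderiv (by simp)).clm_apply continuous_const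

lemma IsTest.compact_partial {ψ : E3 → ℝ} (hψ : IsTest ψ) (v : E3) :
    HasCompactSupport (fun x => fderiv ℝ ψ x v) :=
  hψ.2.fderiv_apply (𝕜 := ℝ) v

lemma L2_locallyIntegrable (f : L2 F) : LocallyIntegrable f (volume : Measure E3) :=
  (Lp.memLp f).locallyIntegrable (by norm_num)

variable [NormedSpace ℝ F]

lemma IsTest.integrable_smul {ψ : E3 → ℝ} (hψ : IsTest ψ) (f : L2 F) :
    Integrable (fun x => ψ x • f x) (volume : Measure E3) :=
  (L2_locallyIntegrable f).integrable_smul_left_of_hasCompactSupport hψ.1.continuous hψ.2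

lemma IsTest.integrable_partial_smul {ψ : E3 → ℝ} (hψ : IsTest ψ) (v : E3) (f : L2 F) :
    Integrable (fun x => fderiv ℝ ψ x v • f x) (volume : Measure E3) :=
  (L2_locallyIntegrable f).integrable_smul_left_of_hasCompactSupport
    (hψ.continuous_partial v) (hψ.compact_partial v)

lemma IsWeakPartial.add {j : Fin 3} {f g f' g' : L2 F}
    (h : IsWeakPartial j f g) (h' : IsWeakPartial j f' g') :
    IsWeakPartial j (f + f' : L2 F) (g + g' : L2 F) := by
  intro ψ hψ
  have e1 : ∫ x, (fderiv ℝ ψ x (basisVec j)) • (f + f' : L2 F) x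
      = ∫ x, ((fderiv ℝ ψ x (basisVec j)) • f x + (fderiv ℝ ψ x (basisVec j)) • f' x) := by
    refine integral_congr_ae ?_
    filter_upwards [Lp.coeFn_add f f'] with x hx
    rw [hx, Pi.add_apply, smul_add]
  have e2 : ∫ x, ψ x • (g + g' : L2 F) x = ∫ x, (ψ x • g x + ψ x • g' x) := by
    refine integral_congr_ae ?_
    filter_upwards [Lp.coeFn_add g g'] with x hx
    rw [hx, Pi.add_apply, smul_add]
  rw [e1, e2, integral_add (hψ.integrable_partial_smul _ f) (hψ.integrable_partial_smul _ f'),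
    integral_add (hψ.integrable_smul g) (hψ.integrable_smul g'), h ψ hψ, h' ψ hψ]
  abel

lemma IsWeakPartial.smul {j : Fin 3} {f g : L2 F} (c : ℝ) (h : IsWeakPartial j f g) :
    IsWeakPartial j (c • f : L2 F) (c • g : L2 F) := by
  intro ψ hψ
  have e1 : ∫ x, (fderiv ℝ ψ x (basisVec j)) • (c • f : L2 F) x
      = ∫ x, c • ((fderiv ℝ ψ x (basisVec j)) • f x) := by
    refine integral_congr_ae ?_
    filter_upwards [Lp.coeFn_smul c f] with x hx
    rw [hx, Pi.smul_apply, smul_comm]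
  have e2 : ∫ x, ψ x • (c • g : L2 F) x = ∫ x, c • (ψ x • g x) := by
    refine integral_congr_ae ?_
    filter_upwards [Lp.coeFn_smul c g] with x hx
    rw [hx, Pi.smul_apply, smul_comm]
  rw [e1, e2, integral_smul, integral_smul, h ψ hψ, smul_neg]

lemma IsWeakPartial.zero (j : Fin 3) : IsWeakPartial j (0 : L2 F) (0 : L2 F) := by
  intro ψ hψ
  have e1 : ∫ x, (fderiv ℝ ψ x (basisVec j)) • (0 : L2 F) x = ∫ _ : E3, (0 : F) := by
    refine integral_congr_ae ?_
    filter_upwards [Lp.coeFn_zero F 2 (volume : Measure E3)] with x hx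
    rw [hx, Pi.zero_apply, smul_zero]
  have e2 : ∫ x, ψ x • (0 : L2 F) x = ∫ _ : E3, (0 : F) := by
    refine integral_congr_ae ?_
    filter_upwards [Lp.coeFn_zero F 2 (volume : Measure E3)] with x hx
    rw [hx, Pi.zero_apply, smul_zero]
  rw [e1, e2]; simp

end Integrability

/-- The Sobolev space `H¹(Σ)` of vector fields (equivalently one-forms), with its usual Hilbert
norm `‖a‖² = ∫ |a|² + ∑_j ∫ |∂_j a|²`: a point carries the field together with its weak partial
derivatives. -/
def H1 : Submodule ℝ Jet where
  carrier := {u | ∀ j, IsWeakPartial j (u none) (u (some j))}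
  add_mem' := fun hu hv j => (hu j).add (hv j)
  zero_mem' := fun j => IsWeakPartial.zero j
  smul_mem' := fun c _ hu j => (hu j).smul c

instance : NormedAddCommGroup H1 := Submodule.normedAddCommGroup H1

instance : InnerProductSpace ℝ H1 := Submodule.innerProductSpace H1

instance : NormedSpace ℝ H1 := Submodule.normedSpace H1

/-- The underlying square integrable field of an element of `H¹(Σ)`. -/
def fld (a : H1) : L2 E3 := (a : Jet) none

/-- The weak partial derivative `∂_j a` of an element of `H¹(Σ)`. -/
def der (a : H1) (j : Fin 3) : L2 E3 := (a : Jet) (some j)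

lemma integrable_fderiv_apply {ψ : E3 → ℝ} (hψ : IsTest ψ) (p : L2 E3) :
    Integrable (fun x => fderiv ℝ ψ x (p x)) (volume : Measure E3) := by
  have h : (fun x => fderiv ℝ ψ x (p x))
      = fun x => ∑ j : Fin 3, (EuclideanSpace.proj j : E3 →L[ℝ] ℝ)
          (fderiv ℝ ψ x (basisVec j) • p x) := by
    funext x
    have hx : p x = ∑ j : Fin 3, (p x) j • basisVec j := by
      ext i
      fin_cases i <;> simp [basisVec, Fin.sum_univ_three]
    conv_lhs => rw [hx, map_sum]
    refine Finset.sum_congr rfl fun j _ => ?_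
    simp [mul_comm]
  rw [h]
  exact integrable_finsetSum _ fun j _ =>
    ContinuousLinearMap.integrable_comp _ (hψ.integrable_partial_smul _ p)

/-- `H(div0, Σ)`: square integrable vector fields with `∂_k p^k = 0` in the weak sense. -/
def Hdiv0 : Submodule ℝ (L2 E3) where
  carrier := {p | ∀ ψ : E3 → ℝ, IsTest ψ → ∫ x, fderiv ℝ ψ x (p x) = 0}
  add_mem' := by
    intro p q hp hq ψ hψ
    have e : ∫ x, fderiv ℝ ψ x ((p + q : L2 E3) x)
        = ∫ x, (fderiv ℝ ψ x (p x) + fderiv ℝ ψ x (q x)) := by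
      refine integral_congr_ae ?_
      filter_upwards [Lp.coeFn_add p q] with x hx
      rw [hx, Pi.add_apply, map_add]
    rw [e, integral_add (integrable_fderiv_apply hψ p) (integrable_fderiv_apply hψ q),
      hp ψ hψ, hq ψ hψ, add_zero]
  zero_mem' := by
    intro ψ hψ
    have e : ∫ x, fderiv ℝ ψ x ((0 : L2 E3) x) = ∫ _ : E3, (0 : ℝ) := by
      refine integral_congr_ae ?_
      filter_upwards [Lp.coeFn_zero E3 2 (volume : Measure E3)] with x hx
      rw [hx, Pi.zero_apply, map_zero]
    rw [e]; simp
  smul_mem' := by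
    intro c p hp ψ hψ
    have e : ∫ x, fderiv ℝ ψ x ((c • p : L2 E3) x) = ∫ x, c • fderiv ℝ ψ x (p x) := by
      refine integral_congr_ae ?_
      filter_upwards [Lp.coeFn_smul c p] with x hx
      rw [hx, Pi.smul_apply, map_smul]
    rw [e, integral_smul, hp ψ hψ, smul_zero]

/-- The inclusion `H¹(Σ) → L²(Σ)`. -/
def fldL : H1 →L[ℝ] L2 E3 := (PiLp.proj 2 (fun _ : Option (Fin 3) => L2 E3) none).comp H1.subtypeL

/-- `H¹(div0, Σ)`. -/
def H1div0 : Submodule ℝ H1 := Hdiv0.comap (fldL : H1 →ₗ[ℝ] L2 E3)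

lemma coord_ae (j : Fin 3) (k : L2 E3) :
    ((EuclideanSpace.proj j : E3 →L[ℝ] ℝ).compLpL 2 volume k : E3 → ℝ) =ᵐ[volume] fun x => k x j :=
  ContinuousLinearMap.coeFn_compLpL _ k

lemma isWeakPartial_congr {F : Type} [NormedAddCommGroup F] [NormedSpace ℝ F] {j : Fin 3}
    {f g f' g' : E3 → F} (hf : f =ᵐ[volume] f') (hg : g =ᵐ[volume] g') :
    IsWeakPartial j f g ↔ IsWeakPartial j f' g' := by
  have key : ∀ {f g f' g' : E3 → F}, f =ᵐ[volume] f' → g =ᵐ[volume] g' →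
      IsWeakPartial j f g → IsWeakPartial j f' g' := by
    intro f g f' g' hf hg h ψ hψ
    have e1 : ∫ x, (fderiv ℝ ψ x (basisVec j)) • f' x
        = ∫ x, (fderiv ℝ ψ x (basisVec j)) • f x := by
      refine integral_congr_ae ?_
      filter_upwards [hf] with x hx
      rw [hx]
    have e2 : ∫ x, ψ x • g' x = ∫ x, ψ x • g x := by
      refine integral_congr_ae ?_
      filter_upwards [hg] with x hx
      rw [hx]
    rw [e1, e2, h ψ hψ]
  exact ⟨key hf hg, key hf.symm hg.symm⟩

/-- `grad H²(Σ)`, as a subspace of `H¹(Σ)`: the fields `∂φ` of class `H¹` with `φ ∈ L²(Σ)`,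
that is, with `φ ∈ H²(Σ)`. -/
def gradH2 : Submodule ℝ H1 where
  carrier := {k | ∃ φ : L2 ℝ, ∀ j, IsWeakPartial j φ (fun x => fld k x j)}
  add_mem' := by
    rintro k l ⟨φ, hφ⟩ ⟨χ, hχ⟩
    refine ⟨φ + χ, fun j => ?_⟩
    have h1 := (isWeakPartial_congr (EventuallyEq.refl _ _) (coord_ae j (fld k))).2 (hφ j)
    have h2 := (isWeakPartial_congr (EventuallyEq.refl _ _) (coord_ae j (fld l))).2 (hχ j)
    refine (isWeakPartial_congr (EventuallyEq.refl _ _) ?_).1 (h1.add h2)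
    rw [← map_add]
    exact coord_ae j _
  zero_mem' := by
    refine ⟨0, fun j => (isWeakPartial_congr (EventuallyEq.refl _ _) ?_).1
      (IsWeakPartial.zero j)⟩
    filter_upwards [Lp.coeFn_zero ℝ 2 (volume : Measure E3),
      Lp.coeFn_zero E3 2 (volume : Measure E3)] with x h1 h2
    have : (fld 0 : E3 → E3) x = 0 := h2
    rw [h1, this]; rfl
  smul_mem' := by
    rintro c k ⟨φ, hφ⟩
    refine ⟨c • φ, fun j => ?_⟩
    have h1 := (isWeakPartial_congr (EventuallyEq.refl _ _) (coord_ae j (fld k))).2 (hφ j)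
    refine (isWeakPartial_congr (EventuallyEq.refl _ _) ?_).1 (h1.smul c)
    rw [← map_smul]
    exact coord_ae j _


/-! ### Rotations -/

/-- The rotation group `SO(3)`. -/
abbrev SO3 : Type := Matrix.specialOrthogonalGroup (Fin 3) ℝ

/-- The Lie algebra `so(3)` of skew-symmetric matrices. -/
abbrev so3 : Type := LieAlgebra.Orthogonal.so (Fin 3) ℝ

lemma exp_mem_SO3 (ξ : so3) :
    NormedSpace.exp (ξ : Matrix (Fin 3) (Fin 3) ℝ) ∈ Matrix.specialOrthogonalGroup (Fin 3) ℝ := by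
  have horth : ∀ A : Matrix (Fin 3) (Fin 3) ℝ, A.transpose = -A →
      NormedSpace.exp A ∈ Matrix.orthogonalGroup (Fin 3) ℝ := by
    intro A hA
    rw [Matrix.mem_orthogonalGroup_iff, ← Matrix.exp_transpose, hA,
      ← Matrix.exp_add_of_commute _ _ (Commute.neg_right (Commute.refl A)), add_neg_cancel,
      NormedSpace.exp_zero]
  have hξ : (ξ : Matrix (Fin 3) (Fin 3) ℝ).transpose = -(ξ : Matrix (Fin 3) (Fin 3) ℝ) :=
    (LieAlgebra.Orthogonal.mem_so (Fin 3) ℝ _).1 ξ.2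
  rw [Matrix.mem_specialOrthogonalGroup_iff]
  refine ⟨horth _ hξ, ?_⟩
  set B : Matrix (Fin 3) (Fin 3) ℝ := (1 / 2 : ℝ) • (ξ : Matrix (Fin 3) (Fin 3) ℝ) with hB
  have hB' : B.transpose = -B := by
    rw [hB, Matrix.transpose_smul, hξ, smul_neg]
  have h2 : (ξ : Matrix (Fin 3) (Fin 3) ℝ) = B + B := by
    rw [hB, ← add_smul]; norm_num
  have h1 := (Matrix.mem_orthogonalGroup_iff (Fin 3) ℝ).1 (horth B hB')
  have h3 := congrArg Matrix.det h1
  rw [Matrix.det_mul, Matrix.det_transpose, Matrix.det_one] at h3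
  rw [h2, Matrix.exp_add_of_commute _ _ (Commute.refl B), Matrix.det_mul, h3]

/-- The exponential map `so(3) → SO(3)`. -/
def expSO3 (ξ : so3) : SO3 := ⟨NormedSpace.exp (ξ : Matrix (Fin 3) (Fin 3) ℝ), exp_mem_SO3 ξ⟩

/-- The rotation `x ↦ R x` of `Σ`. -/
def rot : SO3 →* (E3 ≃ₗᵢ[ℝ] E3) where
  toFun R := Unitary.linearIsometryEquiv
    ⟨Matrix.toEuclideanCLM (n := Fin 3) (𝕜 := ℝ) (R : Matrix (Fin 3) (Fin 3) ℝ),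
      Unitary.map_mem (Matrix.toEuclideanCLM (n := Fin 3) (𝕜 := ℝ))
        ((Matrix.mem_specialOrthogonalGroup_iff).1 R.2).1⟩
  map_one' := by
    ext x : 1
    change Matrix.toEuclideanCLM (n := Fin 3) (𝕜 := ℝ) ((1 : SO3) : Matrix (Fin 3) (Fin 3) ℝ) x = x
    simp
  map_mul' R S := by
    ext x : 1
    change Matrix.toEuclideanCLM (n := Fin 3) (𝕜 := ℝ) ((R * S : SO3) : Matrix (Fin 3) (Fin 3) ℝ) x
      = Matrix.toEuclideanCLM (n := Fin 3) (𝕜 := ℝ) (R : Matrix (Fin 3) (Fin 3) ℝ)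
        (Matrix.toEuclideanCLM (n := Fin 3) (𝕜 := ℝ) (S : Matrix (Fin 3) (Fin 3) ℝ) x)
    simp

/-- The push-forward `p ↦ R p(R⁻¹ x)` of a square integrable field; for an orthogonal matrix
it is also the pull-back of one-forms by `R⁻¹`. -/
def push (ρ : E3 ≃ₗᵢ[ℝ] E3) : L2 E3 →L[ℝ] L2 E3 :=
  ((ρ : E3 →L[ℝ] E3).compLpL 2 volume).comp
    (Lp.compMeasurePreservingₗᵢ ℝ ρ.symm ρ.symm.measurePreserving).toContinuousLinearMap

lemma push_ae (ρ : E3 ≃ₗᵢ[ℝ] E3) (p : L2 E3) :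
    (push ρ p : E3 → E3) =ᵐ[volume] fun x => ρ (p (ρ.symm x)) := by
  have h1 := ContinuousLinearMap.coeFn_compLpL (p := 2) (μ := (volume : Measure E3))
    (ρ : E3 →L[ℝ] E3) (Lp.compMeasurePreserving ρ.symm ρ.symm.measurePreserving p)
  have h2 := Lp.coeFn_compMeasurePreserving p ρ.symm.measurePreserving
  filter_upwards [h1, h2] with x hx1 hx2
  change ((ρ : E3 →L[ℝ] E3).compLpL 2 volume
    (Lp.compMeasurePreserving ρ.symm ρ.symm.measurePreserving p)) x = _
  rw [hx1, hx2]; rfl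

/-- The action of a rotation on jets: `∂_j (R a(R⁻¹ x)) = ∑_k R_{jk} R (∂_k a)(R⁻¹ x)`. -/
def pushJet (ρ : E3 ≃ₗᵢ[ℝ] E3) : Jet →L[ℝ] Jet :=
  ((PiLp.continuousLinearEquiv 2 ℝ (fun _ : Option (Fin 3) => L2 E3)).symm :
      (Option (Fin 3) → L2 E3) →L[ℝ] Jet).comp
    (ContinuousLinearMap.pi fun i : Option (Fin 3) =>
      match i with
      | none => (push ρ).comp (PiLp.proj 2 (fun _ : Option (Fin 3) => L2 E3) none)
      | some j => ∑ k : Fin 3, (ρ.symm (basisVec j) k) •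
          (push ρ).comp (PiLp.proj 2 (fun _ : Option (Fin 3) => L2 E3) (some k)))

lemma pushJet_none (ρ : E3 ≃ₗᵢ[ℝ] E3) (u : Jet) : pushJet ρ u none = push ρ (u none) := rfl

lemma pushJet_some (ρ : E3 ≃ₗᵢ[ℝ] E3) (u : Jet) (j : Fin 3) :
    pushJet ρ u (some j) = ∑ k : Fin 3, (ρ.symm (basisVec j) k) • push ρ (u (some k)) := by
  simp [pushJet]

lemma IsTest.comp_rot {ψ : E3 → ℝ} (hψ : IsTest ψ) (ρ : E3 ≃ₗᵢ[ℝ] E3) :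
    IsTest (fun x => ψ (ρ x)) :=
  ⟨hψ.1.comp ρ.contDiff, hψ.2.comp_homeomorph ρ.toHomeomorph⟩

lemma fderiv_comp_rot {ψ : E3 → ℝ} (hψ : IsTest ψ) (ρ : E3 ≃ₗᵢ[ℝ] E3) (y v : E3) :
    fderiv ℝ (fun x => ψ (ρ x)) y v = fderiv ℝ ψ (ρ y) (ρ v) := by
  have hd : DifferentiableAt ℝ ψ (ρ y) := (hψ.1.differentiable (by simp)).differentiableAt
  have := hd.hasFDerivAt.comp y (ρ : E3 →L[ℝ] E3).hasFDerivAt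
  have h2 : fderiv ℝ (fun x => ψ (ρ x)) y = (fderiv ℝ ψ (ρ y)).comp (ρ : E3 →L[ℝ] E3) :=
    this.fderiv
  rw [h2]; rfl

lemma sum_basisVec (v : E3) : v = ∑ k : Fin 3, v k • basisVec k := by
  ext i
  fin_cases i <;> simp [basisVec, Fin.sum_univ_three]

lemma integral_rot {F : Type} [NormedAddCommGroup F] [NormedSpace ℝ F]
    (ρ : E3 ≃ₗᵢ[ℝ] E3) (f : E3 → F) : ∫ x, f (ρ x) = ∫ x, f x :=
  ρ.measurePreserving.integral_comp ρ.toHomeomorph.measurableEmbedding f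

/-- Weak gradients transform by rotations: general form with a linear action `T` on the values. -/
lemma weakPartial_rot {F : Type} [NormedAddCommGroup F] [NormedSpace ℝ F] [CompleteSpace F]
    (ρ : E3 ≃ₗᵢ[ℝ] E3) (T : F →L[ℝ] F) (f : L2 F) (g : Fin 3 → L2 F)
    (h : ∀ k, IsWeakPartial k f (g k)) (j : Fin 3) :
    IsWeakPartial j (fun x => T (f (ρ.symm x)))
      (fun x => ∑ k : Fin 3, (ρ.symm (basisVec j) k) • T (g k (ρ.symm x))) := by
  intro ψ hψ
  have hψ' := hψ.comp_rot ρ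
  rw [← integral_rot ρ, ← integral_rot ρ (fun x => ψ x • _)]
  simp only [LinearIsometryEquiv.symm_apply_apply]
  have e1 : ∀ y, fderiv ℝ ψ (ρ y) (basisVec j) • T (f y)
      = ∑ k : Fin 3, (ρ.symm (basisVec j) k) •
          T (fderiv ℝ (fun x => ψ (ρ x)) y (basisVec k) • f y) := by
    intro y
    have : basisVec j = ρ (∑ k : Fin 3, (ρ.symm (basisVec j) k) • basisVec k) := by
      rw [← sum_basisVec, LinearIsometryEquiv.apply_symm_apply]
    conv_lhs => rw [this, ← fderiv_comp_rot hψ, map_sum, Finset.sum_smul]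
    refine Finset.sum_congr rfl fun k _ => ?_
    rw [map_smul, map_smul, smul_assoc]
  have e2 : ∀ y, ψ (ρ y) • ∑ k : Fin 3, (ρ.symm (basisVec j) k) • T (g k y)
      = ∑ k : Fin 3, (ρ.symm (basisVec j) k) • T (ψ (ρ y) • g k y) := by
    intro y
    rw [Finset.smul_sum]
    refine Finset.sum_congr rfl fun k _ => ?_
    rw [map_smul, smul_comm]
  simp_rw [e1, e2]
  have i1 : ∀ k : Fin 3, Integrable (fun y => (ρ.symm (basisVec j) k) •
      T (fderiv ℝ (fun x => ψ (ρ x)) y (basisVec k) • f y)) (volume : Measure E3) := fun k =>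
    (T.integrable_comp (hψ'.integrable_partial_smul _ f)).smul _
  have i2 : ∀ k : Fin 3, Integrable (fun y => (ρ.symm (basisVec j) k) •
      T (ψ (ρ y) • g k y)) (volume : Measure E3) := fun k =>
    (T.integrable_comp (hψ'.integrable_smul (g k))).smul _
  rw [integral_finsetSum _ (fun k _ => i1 k), integral_finsetSum _ (fun k _ => i2 k),
    ← Finset.sum_neg_distrib]
  refine Finset.sum_congr rfl fun k _ => ?_
  rw [integral_smul, integral_smul, T.integral_comp_comm (hψ'.integrable_partial_smul _ f),
    T.integral_comp_comm (hψ'.integrable_smul (g k)), h k _ hψ', map_neg, smul_neg]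

lemma sum_smul_ae {F : Type} [NormedAddCommGroup F] [NormedSpace ℝ F] (c : Fin 3 → ℝ)
    (g : Fin 3 → L2 F) :
    ((∑ k : Fin 3, c k • g k : L2 F) : E3 → F) =ᵐ[volume] fun x => ∑ k : Fin 3, c k • g k x := by
  simp only [Fin.sum_univ_three]
  filter_upwards [Lp.coeFn_add (c 0 • g 0 + c 1 • g 1) (c 2 • g 2),
    Lp.coeFn_add (c 0 • g 0) (c 1 • g 1), Lp.coeFn_smul (c 0) (g 0), Lp.coeFn_smul (c 1) (g 1),
    Lp.coeFn_smul (c 2) (g 2)] with x h1 h2 h3 h4 h5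
  rw [h1, Pi.add_apply, h2, Pi.add_apply, h3, h4, h5]; rfl

lemma pushJet_mem_H1 (ρ : E3 ≃ₗᵢ[ℝ] E3) (u : H1) : pushJet ρ u ∈ H1 := by
  intro j
  rw [pushJet_none, pushJet_some]
  refine (isWeakPartial_congr (push_ae ρ _) ?_).2
    (weakPartial_rot ρ (ρ : E3 →L[ℝ] E3) ((u : Jet) none) (fun k => (u : Jet) (some k)) u.2 j)
  refine (sum_smul_ae _ _).trans ?_
  filter_upwards [push_ae ρ ((u : Jet) (some 0)), push_ae ρ ((u : Jet) (some 1)),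
    push_ae ρ ((u : Jet) (some 2))] with x h0 h1 h2
  simp only [Fin.sum_univ_three, h0, h1, h2]; rfl

lemma push_mem_Hdiv0 (ρ : E3 ≃ₗᵢ[ℝ] E3) {p : L2 E3} (hp : p ∈ Hdiv0) : push ρ p ∈ Hdiv0 := by
  intro ψ hψ
  have e : ∫ x, fderiv ℝ ψ x (push ρ p x) = ∫ x, fderiv ℝ ψ x (ρ (p (ρ.symm x))) := by
    refine integral_congr_ae ?_
    filter_upwards [push_ae ρ p] with x hx
    rw [hx]
  rw [e, ← integral_rot ρ]
  simp only [LinearIsometryEquiv.symm_apply_apply]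
  simp_rw [← fderiv_comp_rot hψ ρ]
  exact hp _ (hψ.comp_rot ρ)

/-- The rotation action on `H¹(Σ)`. -/
def rotH1 (R : SO3) : H1 →L[ℝ] H1 :=
  ((pushJet (rot R)).comp H1.subtypeL).codRestrict H1 (pushJet_mem_H1 (rot R))

/-- The rotation action on `H(div0, Σ)`. -/
def rotHdiv0 (R : SO3) : Hdiv0 →L[ℝ] Hdiv0 :=
  ((push (rot R)).comp Hdiv0.subtypeL).codRestrict Hdiv0 (fun p => push_mem_Hdiv0 (rot R) p.2)

lemma rotH1_mem_H1div0 (R : SO3) (a : H1div0) : rotH1 R a ∈ H1div0 :=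
  push_mem_Hdiv0 (rot R) (p := fld a) a.2

/-- The rotation action on `H¹(div0, Σ)`. -/
def rotH1div0 (R : SO3) : H1div0 →L[ℝ] H1div0 :=
  ((rotH1 R).comp H1div0.subtypeL).codRestrict H1div0 (rotH1_mem_H1div0 R)

lemma rotH1_mem_gradH2 (R : SO3) {k : H1} (hk : k ∈ gradH2) : rotH1 R k ∈ gradH2 := by
  obtain ⟨φ, hφ⟩ := hk
  set ρ := rot R
  refine ⟨Lp.compMeasurePreserving ρ.symm ρ.symm.measurePreserving φ, fun j => ?_⟩
  have h := weakPartial_rot ρ (ContinuousLinearMap.id ℝ ℝ) φ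
    (fun i => (EuclideanSpace.proj i : E3 →L[ℝ] ℝ).compLpL 2 volume (fld k))
    (fun i => (isWeakPartial_congr (EventuallyEq.refl _ _) (coord_ae i (fld k))).2 (hφ i)) j
  refine (isWeakPartial_congr ?_ ?_).1 h
  · exact (Lp.coeFn_compMeasurePreserving φ ρ.symm.measurePreserving).symm
  · have hq : ∀ i, ∀ᵐ x : E3, ((EuclideanSpace.proj i : E3 →L[ℝ] ℝ).compLpL 2 volume (fld k))
        (ρ.symm x) = fld k (ρ.symm x) i := fun i =>
      ρ.symm.measurePreserving.quasiMeasurePreserving.ae (coord_ae i (fld k))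
    filter_upwards [hq 0, hq 1, hq 2, push_ae ρ (fld k)] with x h0 h1 h2 h3
    have h4 : fld (rotH1 R k) x = ρ (fld k (ρ.symm x)) := h3
    simp only [Fin.sum_univ_three, ContinuousLinearMap.id_apply, h0, h1, h2, h4]
    have key : ∀ v : E3, (ρ v) j = inner ℝ (ρ.symm (basisVec j)) v := by
      intro v
      rw [← LinearIsometryEquiv.inner_map_map ρ, LinearIsometryEquiv.apply_symm_apply]
      simp [basisVec, EuclideanSpace.inner_single_left]
    rw [key]
    simp [PiLp.inner_apply, Fin.sum_univ_three, mul_comm]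

/-- The characteristic space `K`: the gradient directions, i.e. the closure of `grad H²(Σ)` in
`H¹(Σ)`. -/
def K : Submodule ℝ H1 := gradH2.topologicalClosure

instance : NormedAddCommGroup K := Submodule.normedAddCommGroup K

instance : InnerProductSpace ℝ K := Submodule.innerProductSpace K

instance : NormedSpace ℝ K := Submodule.normedSpace K

lemma rotH1_mem_K (R : SO3) (k : K) : rotH1 R k ∈ K :=
  map_mem_closure (rotH1 R).continuous k.2 (fun _ hk => rotH1_mem_gradH2 R hk)

/-- The rotation action on `K`. -/
def rotK (R : SO3) : K →L[ℝ] K :=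
  ((rotH1 R).comp K.subtypeL).codRestrict K (rotH1_mem_K R)

/-- The dual (contragredient) action on `K*`: `μ ↦ μ ∘ R⁻¹`. -/
def rotKdual (R : SO3) : (K →L[ℝ] ℝ) →L[ℝ] (K →L[ℝ] ℝ) :=
  (ContinuousLinearMap.compL ℝ K K ℝ).flip (rotK R⁻¹)

/-! ### The final constraint manifold and its coisotropic extension -/

/-- The final constraint manifold `M_∞ = H¹(Σ) × H(div0, Σ)`, with points `(a, p)`. -/
abbrev Minf : Type := H1 × Hdiv0

/-- The pre-symplectic form `∫ (X_a · Y_p - X_p · Y_a)` of `M_∞`. -/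
def omegaM (X Y : Minf) : ℝ :=
  ∫ x, ∑ k : Fin 3, (fld X.1 x k * (Y.2 : L2 E3) x k - (X.2 : L2 E3) x k * fld Y.1 x k)

/-- The extension `P = H¹(div0, Σ) × K × H(div0, Σ) × K*`, with points `(ã, ∂φ, p, μ)`. -/
abbrev P : Type := H1div0 × K × Hdiv0 × (K →L[ℝ] ℝ)

/-- The component `ã`. -/
def pot (m : P) : H1 := m.1

/-- The component `∂φ`. -/
def dphi (m : P) : K := m.2.1

/-- The component `p`. -/
def mom (m : P) : L2 E3 := (m.2.2.1 : Hdiv0)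

/-- The component `μ`. -/
def mu (m : P) : K →L[ℝ] ℝ := m.2.2.2

/-- The symplectic form of `P`. The sign `ε` is the convention for the canonical form on
`K × K*`: it is `dZ ∧ dμ` for `ε = 1` and `dμ ∧ dZ` for `ε = -1`. -/
def omegaP (ε : ℝ) (X Y : P) : ℝ :=
  (∫ x, ∑ k : Fin 3, (fld (pot X) x k * mom Y x k - mom X x k * fld (pot Y) x k))
    + ε * (mu Y (dphi X) - mu X (dphi Y))

/-- The bundle projection `P → M_∞`, `(ã, ∂φ, p, μ) ↦ (ã + ∂φ, p)`. -/
def toMinf (m : P) : Minf := (pot m + (dphi m : H1), m.2.2.1)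

/-- The rotation action on `M_∞`: pull-back by `R⁻¹` on `a`, push-forward by `R` on `p`. -/
def actM (R : SO3) : Minf →L[ℝ] Minf := (rotH1 R).prodMap (rotHdiv0 R)

/-- The lifted rotation action on `P`. -/
def actP (R : SO3) : P →L[ℝ] P :=
  (rotH1div0 R).prodMap ((rotK R).prodMap ((rotHdiv0 R).prodMap (rotKdual R)))

/-! ### Hamiltonian actions of `SO(3)` -/

section Hamiltonian

variable {V : Type} [NormedAddCommGroup V] [NormedSpace ℝ V]

/-- The common domain of the generators: the points at which the orbit map is differentiable
along every one-parameter subgroup. -/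
def genDomain (T : SO3 → V →L[ℝ] V) : Set V :=
  {m | ∀ ξ : so3, DifferentiableAt ℝ (fun θ : ℝ => T (expSO3 (θ • ξ)) m) 0}

/-- The fundamental (Killing) vector field `X_ξ(m) = d/dθ [exp(θ ξ) · m]` at `θ = 0`. -/
def fundField (T : SO3 → V →L[ℝ] V) (ξ : so3) (m : V) : V :=
  deriv (fun θ : ℝ => T (expSO3 (θ • ξ)) m) 0

/-- `J` is a momentum map for the action `T` with respect to the constant two-form `Ω`:
`dJ_ξ = i_{X_ξ} Ω`, where the differential is the Fréchet differential on the domain of the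
(unbounded) generators, for the graph norm `‖Y‖ + ‖X_ξ(Y)‖`. -/
def IsMomentumMap (T : SO3 → V →L[ℝ] V) (Ω : V → V → ℝ) (J : V → Module.Dual ℝ so3) : Prop :=
  ∀ ξ : so3, ∀ m ∈ genDomain T, ∀ c > (0 : ℝ), ∃ δ > (0 : ℝ), ∀ Y ∈ genDomain T,
    ‖Y‖ + ‖fundField T ξ Y‖ < δ →
      |J (m + Y) ξ - J m ξ - Ω (fundField T ξ m) Y| ≤ c * (‖Y‖ + ‖fundField T ξ Y‖)

/-- `T` is a (strongly continuous) Hamiltonian action on `(V, Ω)` with momentum map `J`. -/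
structure IsHamiltonianAction (T : SO3 → V →L[ℝ] V) (Ω : V → V → ℝ)
    (J : V → Module.Dual ℝ so3) : Prop where
  map_one : ∀ m, T 1 m = m
  map_mul : ∀ R S m, T (R * S) m = T R (T S m)
  continuous_orbit : ∀ m, Continuous fun R => T R m
  canonical : ∀ R X Y, Ω (T R X) (T R Y) = Ω X Y
  dense_domain : Dense (genDomain T)
  momentum : IsMomentumMap T Ω J

end Hamiltonian

/-! ### The currents -/

/-- The generators `ξ_j` of the rotations around the axes: `ξ_j v = e_j × v`. -/
def xi : Fin 3 → so3
  | 0 => ⟨!![0, 0, 0; 0, 0, -1; 0, 1, 0], by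
      rw [LieAlgebra.Orthogonal.mem_so]; ext i j; fin_cases i <;> fin_cases j <;> simp⟩
  | 1 => ⟨!![0, 0, 1; 0, 0, 0; -1, 0, 0], by
      rw [LieAlgebra.Orthogonal.mem_so]; ext i j; fin_cases i <;> fin_cases j <;> simp⟩
  | 2 => ⟨!![0, -1, 0; 1, 0, 0; 0, 0, 0], by
      rw [LieAlgebra.Orthogonal.mem_so]; ext i j; fin_cases i <;> fin_cases j <;> simp⟩

/-- The linear form on `so(3)` reading off a matrix entry. -/
def entry (k l : Fin 3) : Module.Dual ℝ so3 where
  toFun ξ := (ξ : Matrix (Fin 3) (Fin 3) ℝ) k l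
  map_add' _ _ := rfl
  map_smul' _ _ := rfl

/-- The dual basis of `ξ_1, ξ_2, ξ_3`. -/
def xiDual : Fin 3 → Module.Dual ℝ so3
  | 0 => entry 2 1
  | 1 => entry 0 2
  | 2 => entry 1 0

/-- `(x^k ∂_l - x^l ∂_k) a_i`. -/
def orb (k l : Fin 3) (a : H1) (i : Fin 3) (x : E3) : ℝ := x k * der a l x i - x l * der a k x i

/-- The components of the infinitesimal rotation of a field around the three axes. -/
def rotField : Fin 3 → H1 → E3 → E3
  | 0, a, x => !₂[orb 2 1 a 0 x, orb 2 1 a 1 x - fld a x 2, orb 2 1 a 2 x + fld a x 1]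
  | 1, a, x => !₂[orb 0 2 a 0 x + fld a x 2, orb 0 2 a 1 x, orb 0 2 a 2 x - fld a x 0]
  | 2, a, x => !₂[orb 1 0 a 0 x - fld a x 1, orb 1 0 a 1 x + fld a x 0, orb 1 0 a 2 x]

open Classical in
/-- The pairing `⟨μ, f⟩` of `μ ∈ K*` with a field `f` that represents an element of `K`
(and `0` if it does not). -/
def pairK (μ : K →L[ℝ] ℝ) (f : E3 → E3) : ℝ :=
  if h : ∃ k : K, (fld (k : H1) : E3 → E3) =ᵐ[volume] f then μ h.choose else 0

/-- The explicit current `J_{ξ_j}(ã, ∂φ, p, μ)`. -/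
def current (ε : ℝ) (j : Fin 3) (m : P) : ℝ :=
  (∫ x, ∑ i : Fin 3, rotField j (pot m) x i * mom m x i)
    + ε * pairK (mu m) (rotField j (dphi m : H1))

/-- The map `P → so(3)*` with components `J_{ξ_j}`. -/
def momentumP (ε : ℝ) (m : P) : Module.Dual ℝ so3 := ∑ j : Fin 3, current ε j m • xiDual j

/-- The electric field `E = -p`. -/
def electric (m : Minf) (x : E3) : E3 := - (m.2 : L2 E3) x

/-- The canonical momentum density `T^{0l} = E^i ∂_l a_i`. -/
def momentumDensity (m : Minf) (l : Fin 3) (x : E3) : ℝ :=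
  ∑ i : Fin 3, electric m x i * der m.1 l x i

/-- The components `M^{0kl}` of the canonical (generalized) angular momentum tensor of the
electromagnetic field: orbital part plus spin part. -/
def angularMomentumTensor (k l : Fin 3) (m : Minf) (x : E3) : ℝ :=
  x k * momentumDensity m l x - x l * momentumDensity m k x
    + electric m x k * fld m.1 x l - electric m x l * fld m.1 x k

/-- The density of the angular momentum around the three axes, `M^{023}`, `M^{031}`, `M^{012}`. -/
def angularMomentumDensity : Fin 3 → Minf → E3 → ℝ
  | 0 => angularMomentumTensor 1 2
  | 1 => angularMomentumTensor 2 0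
  | 2 => angularMomentumTensor 0 1

/-- The angular momentum of the electromagnetic field, as a map `M_∞ → so(3)*`. -/
def momentumM (m : Minf) : Module.Dual ℝ so3 :=
  ∑ j : Fin 3, (∫ x, angularMomentumDensity j m x) • xiDual j

/-! ### The Coulomb connection and the abstract momentum map -/

/-- The vertical part in `K` of a tangent vector of `M_∞`, with respect to the splitting
`H¹(Σ) = H¹(div0, Σ) ⊕ K`. It is the gradient field `∂ Δ⁻¹ (∂_j X_{a_j})`: the element of `K`
with the same divergence as `X_a`. -/
def vertical (h : IsCompl H1div0 K) (X : Minf) : K := Submodule.projectionOnto K H1div0 h.symm X.1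

/-- The Coulomb connection `ℛ` on `M_∞`, as the projection onto its horizontal vectors. -/
def coulomb (h : IsCompl H1div0 K) (X : Minf) : Minf := (X.1 - (vertical h X : H1), X.2)

/-- The extension `ℛ↑` of the Coulomb connection to `P`: `X ⊕ κ ↦ ℛ(X) ⊕ κ`. -/
def coulombUp (X : P) : P := (X.1, 0, X.2.2.1, X.2.2.2)

/-- The abstract momentum map `⟨J_P(m, μ), ξ⟩ = ⟨J(m), ξ⟩ + ⟨μ, A_m(ξ)⟩`, where `A_m(ξ)` is the
vertical part of `X_ξ(m)` for the Coulomb connection and `J` is the momentum map on `M_∞`.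
The sign `ε` is that of the canonical form on `K × K*`. -/
def abstractMomentum (h : IsCompl H1div0 K) (ε : ℝ) (m : P) (ξ : so3) : ℝ :=
  momentumM (toMinf m) ξ + ε * mu m (vertical h (fundField actM ξ (toMinf m)))

end Maxwell

end

/-!
The proof rests on two facts: one about the equation `Δf = f`, one about invariant bilinear forms.

*Analysis.* A square integrable `f` with `Δf = f` in the sense of distributions vanishes
(`ae_eq_zero_of_laplacian_eq_self`): its mollifications are smooth solutions tending to zero at
infinity, so that the maximum principle applies. Since a field orthogonal in `H¹(Σ)` to all test
fields solves `Δa = a`, test fields are dense in `H¹(Σ)` (`eq_zero_of_inner_testH1`). Likewise the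
divergence of a field orthogonal to the gradients of test functions solves this equation; hence the
orthogonal complement of these gradients is `H¹(div0, Σ)` (`mem_H1div0_iff_inner`). By density,
gradients in `K` are orthogonal in `L²` to all divergence free fields (`inner_fld_K`), which shows
that `K` is the closed span of the gradients of test functions (`K_eq_testGradients`). Thus
`H¹(Σ) = H¹(div0, Σ) ⊕ K` is an orthogonal splitting (`isCompl_H1div0_K`), and the kernel of the
two-form on `M_∞`, the nondegeneracy on `P` and the coisotropy of `{μ = 0}` follow from
orthogonality and density.

*Rotations.* Both two-forms are antisymmetrizations `B(X, Y) - B(Y, X)` of bounded bilinear forms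
invariant under the rotations. Differentiating the invariance gives `B(X_ξ m, Y) + B(m, X_ξ Y) = 0`
on the domain of the generators, whence `m ↦ B(X_ξ m, m)` is the component along `ξ` of a momentum
map (`isMomentumMap_of_bilinear`). Test fields are differentiable vectors in `L²` and `H¹(Σ)`, by
dominated convergence; strong continuity and density of the domain pass to the invariant subspaces
by orthogonal projection, and to `K*` by the Riesz isomorphism (`IsDenselyGenerated.map`). Pairing
with test fields and integrating by parts identifies the generator on `H¹(Σ)` as the differential
operator `ξ a - (ξx · ∂) a` on its whole domain (`fld_fundField_rotH1`), which turns `B(X_ξ m, m)`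
into the explicit currents. The gradient part of the potential drops out of the charges at `μ = 0`,
because its infinitesimal rotation lies in `K`.
-/

namespace Maxwell

/-! ### Linear actions of the rotation group and their generators -/

section Action

variable {V W : Type} [NormedAddCommGroup V] [NormedSpace ℝ V]
  [NormedAddCommGroup W] [NormedSpace ℝ W]

lemma expSO3_zero (ξ : so3) : expSO3 ((0 : ℝ) • ξ) = 1 := by
  apply Subtype.ext
  simp [expSO3]

lemma hasDerivAt_orbit {T : SO3 → V →L[ℝ] V} {m : V} (hm : m ∈ genDomain T) (ξ : so3) :
    HasDerivAt (fun θ : ℝ => T (expSO3 (θ • ξ)) m) (fundField T ξ m) 0 :=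
  (hm ξ).hasDerivAt

lemma mem_genDomain_of_hasDerivAt {T : SO3 → V →L[ℝ] V} {m : V} (X : so3 → V)
    (h : ∀ ξ, HasDerivAt (fun θ : ℝ => T (expSO3 (θ • ξ)) m) (X ξ) 0) : m ∈ genDomain T :=
  fun ξ => (h ξ).differentiableAt

lemma hasDerivAt_orbit_map {T : SO3 → V →L[ℝ] V} {S : SO3 → W →L[ℝ] W} (A : V →L[ℝ] W)
    (hA : ∀ R m, A (T R m) = S R (A m)) {m : V} (hm : m ∈ genDomain T) (ξ : so3) :
    HasDerivAt (fun θ : ℝ => S (expSO3 (θ • ξ)) (A m)) (A (fundField T ξ m)) 0 := by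
  have := A.hasFDerivAt.comp_hasDerivAt (0 : ℝ) (hasDerivAt_orbit hm ξ)
  simpa only [Function.comp_def, hA] using this

/-- A bounded intertwining operator maps the domain of the generators into the domain of the
generators. -/
lemma map_mem_genDomain {T : SO3 → V →L[ℝ] V} {S : SO3 → W →L[ℝ] W} (A : V →L[ℝ] W)
    (hA : ∀ R m, A (T R m) = S R (A m)) {m : V} (hm : m ∈ genDomain T) : A m ∈ genDomain S :=
  mem_genDomain_of_hasDerivAt _ (hasDerivAt_orbit_map A hA hm)

lemma fundField_map {T : SO3 → V →L[ℝ] V} {S : SO3 → W →L[ℝ] W} (A : V →L[ℝ] W)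
    (hA : ∀ R m, A (T R m) = S R (A m)) {m : V} (hm : m ∈ genDomain T) (ξ : so3) :
    fundField S ξ (A m) = A (fundField T ξ m) :=
  (hasDerivAt_orbit_map A hA hm ξ).deriv

lemma dense_genDomain_map {T : SO3 → V →L[ℝ] V} {S : SO3 → W →L[ℝ] W} (A : V →L[ℝ] W)
    (hA : ∀ R m, A (T R m) = S R (A m)) (hs : Function.Surjective A)
    (h : Dense (genDomain T)) : Dense (genDomain S) := by
  refine (hs.denseRange.dense_image A.continuous h).mono ?_
  rintro _ ⟨m, hm, rfl⟩
  exact map_mem_genDomain A hA hm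

lemma hasDerivAt_orbit_add {T : SO3 → V →L[ℝ] V} {m n : V} (hm : m ∈ genDomain T)
    (hn : n ∈ genDomain T) (ξ : so3) :
    HasDerivAt (fun θ : ℝ => T (expSO3 (θ • ξ)) (m + n)) (fundField T ξ m + fundField T ξ n) 0 := by
  simpa only [map_add] using! (hasDerivAt_orbit hm ξ).add (hasDerivAt_orbit hn ξ)

lemma add_mem_genDomain {T : SO3 → V →L[ℝ] V} {m n : V} (hm : m ∈ genDomain T)
    (hn : n ∈ genDomain T) : m + n ∈ genDomain T :=
  mem_genDomain_of_hasDerivAt _ (hasDerivAt_orbit_add hm hn)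

lemma fundField_add {T : SO3 → V →L[ℝ] V} {m n : V} (hm : m ∈ genDomain T)
    (hn : n ∈ genDomain T) (ξ : so3) :
    fundField T ξ (m + n) = fundField T ξ m + fundField T ξ n :=
  (hasDerivAt_orbit_add hm hn ξ).deriv

/-- The infinitesimal form of the invariance of a bounded bilinear pairing. -/
lemma pairing_fundField {T : SO3 → V →L[ℝ] V} {S : SO3 → W →L[ℝ] W}
    (hT : ∀ m, T 1 m = m) (hS : ∀ m, S 1 m = m)
    (B : V →L[ℝ] W →L[ℝ] ℝ) (hB : ∀ R v w, B (T R v) (S R w) = B v w)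
    {v : V} {w : W} (hv : v ∈ genDomain T) (hw : w ∈ genDomain S) (ξ : so3) :
    B (fundField T ξ v) w + B v (fundField S ξ w) = 0 := by
  have h1 : HasDerivAt (fun θ : ℝ => B (T (expSO3 (θ • ξ)) v)) (B (fundField T ξ v)) 0 :=
    B.hasFDerivAt.comp_hasDerivAt (0 : ℝ) (hasDerivAt_orbit hv ξ)
  have h2 := h1.clm_apply (hasDerivAt_orbit hw ξ)
  simp only [hB, expSO3_zero, hT, hS] at h2
  exact h2.unique (hasDerivAt_const _ _)

lemma mem_genDomain_prod {T : SO3 → V →L[ℝ] V} {S : SO3 → W →L[ℝ] W} {m : V × W} :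
    m ∈ genDomain (fun R => (T R).prodMap (S R)) ↔ m.1 ∈ genDomain T ∧ m.2 ∈ genDomain S := by
  constructor
  · intro h
    exact ⟨map_mem_genDomain (ContinuousLinearMap.fst ℝ V W) (fun _ _ => rfl) h,
      map_mem_genDomain (ContinuousLinearMap.snd ℝ V W) (fun _ _ => rfl) h⟩
  · rintro ⟨h1, h2⟩ ξ
    exact (h1 ξ).prodMk (h2 ξ)

lemma fundField_prod {T : SO3 → V →L[ℝ] V} {S : SO3 → W →L[ℝ] W} {m : V × W}
    (h : m ∈ genDomain (fun R => (T R).prodMap (S R))) (ξ : so3) :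
    fundField (fun R => (T R).prodMap (S R)) ξ m = (fundField T ξ m.1, fundField S ξ m.2) :=
  Prod.ext
    (fundField_map (ContinuousLinearMap.fst ℝ V W) (fun _ _ => rfl) h ξ).symm
    (fundField_map (ContinuousLinearMap.snd ℝ V W) (fun _ _ => rfl) h ξ).symm

lemma dense_genDomain_prod {T : SO3 → V →L[ℝ] V} {S : SO3 → W →L[ℝ] W}
    (hT : Dense (genDomain T)) (hS : Dense (genDomain S)) :
    Dense (genDomain (fun R => (T R).prodMap (S R))) := by
  refine (hT.prod hS).mono fun m hm => mem_genDomain_prod.2 hm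

/-- Strongly continuous linear actions whose generators have a common dense domain. -/
structure IsDenselyGenerated (T : SO3 → V →L[ℝ] V) : Prop where
  map_one : ∀ m, T 1 m = m
  map_mul : ∀ R S m, T (R * S) m = T R (T S m)
  continuous_orbit : ∀ m, Continuous fun R => T R m
  dense_domain : Dense (genDomain T)

/-- All properties of `IsDenselyGenerated` pass to quotients of an action. -/
lemma IsDenselyGenerated.map {T : SO3 → V →L[ℝ] V} {S : SO3 → W →L[ℝ] W}
    (hT : IsDenselyGenerated T) (A : V →L[ℝ] W) (hA : ∀ R m, A (T R m) = S R (A m))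
    (hs : Function.Surjective A) : IsDenselyGenerated S where
  map_one m := by
    obtain ⟨v, rfl⟩ := hs m
    rw [← hA, hT.map_one]
  map_mul R R' m := by
    obtain ⟨v, rfl⟩ := hs m
    rw [← hA, ← hA, ← hA, hT.map_mul]
  continuous_orbit m := by
    obtain ⟨v, rfl⟩ := hs m
    simp only [← hA]
    exact A.continuous.comp (hT.continuous_orbit v)
  dense_domain := dense_genDomain_map A hA hs hT.dense_domain

lemma IsDenselyGenerated.prod {T : SO3 → V →L[ℝ] V} {S : SO3 → W →L[ℝ] W}
    (hT : IsDenselyGenerated T) (hS : IsDenselyGenerated S) :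
    IsDenselyGenerated (fun R => (T R).prodMap (S R)) where
  map_one _ := Prod.ext (hT.map_one _) (hS.map_one _)
  map_mul _ _ _ := Prod.ext (hT.map_mul _ _ _) (hS.map_mul _ _ _)
  continuous_orbit m := (hT.continuous_orbit m.1).prodMk (hS.continuous_orbit m.2)
  dense_domain := dense_genDomain_prod hT.dense_domain hS.dense_domain

/-- If the two-form is the antisymmetrization of a bounded invariant bilinear form `B`, then the
quadratic functions `m ↦ B (X_ξ m, m)` are the components of a momentum map: the remainder of the
first-order expansion at `m` is `B (X_ξ Y, Y)`, which is quadratic in the graph norm. -/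
lemma isMomentumMap_of_bilinear {T : SO3 → V →L[ℝ] V} (hT : ∀ m, T 1 m = m)
    (B : V →L[ℝ] V →L[ℝ] ℝ) (hB : ∀ R v w, B (T R v) (T R w) = B v w)
    {Ω : V → V → ℝ} (hΩ : ∀ v w, Ω v w = B v w - B w v) {J : V → Module.Dual ℝ so3}
    (hJ : ∀ m ∈ genDomain T, ∀ ξ, J m ξ = B (fundField T ξ m) m) :
    IsMomentumMap T Ω J := by
  intro ξ m hm c hc
  have hC : 0 < ‖B‖ + 1 := by positivity
  refine ⟨c / (‖B‖ + 1), by positivity, fun Y hY hδ => ?_⟩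
  have key : J (m + Y) ξ - J m ξ - Ω (fundField T ξ m) Y = B (fundField T ξ Y) Y := by
    rw [hJ _ (add_mem_genDomain hm hY), hJ _ hm, hΩ, fundField_add hm hY]
    have := pairing_fundField hT hT B hB hY hm ξ
    simp only [map_add, _root_.add_apply]
    linarith
  rw [key]
  set s := ‖Y‖ + ‖fundField T ξ Y‖ with hs
  have h1 : ‖B (fundField T ξ Y) Y‖ ≤ ‖B‖ * ‖fundField T ξ Y‖ * ‖Y‖ := B.le_opNorm₂ _ _
  have hY0 := norm_nonneg Y
  have hX0 := norm_nonneg (fundField T ξ Y)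
  have h2 : ‖fundField T ξ Y‖ * ‖Y‖ ≤ s * s := by
    apply mul_le_mul <;> linarith
  have h3 : (‖B‖ + 1) * s ≤ c := by
    rw [lt_div_iff₀ hC] at hδ; linarith
  have hs0 : 0 ≤ s := by positivity
  rw [← Real.norm_eq_abs]
  calc ‖B (fundField T ξ Y) Y‖ ≤ ‖B‖ * (‖fundField T ξ Y‖ * ‖Y‖) := by rw [← mul_assoc]; exact h1
    _ ≤ (‖B‖ + 1) * (s * s) := by
        apply mul_le_mul (by linarith) h2 (by positivity) (by positivity)
    _ = ((‖B‖ + 1) * s) * s := by ring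
    _ ≤ c * s := by gcongr

end Action

/-! ### Uniqueness for the equation `Δf = f` among square integrable functions -/

section Uniqueness

open scoped Convolution

/-- The partial derivative `∂_i η`. -/
noncomputable def pd (i : Fin 3) (η : E3 → ℝ) : E3 → ℝ := fun x => fderiv ℝ η x (basisVec i)

lemma IsTest.pd {η : E3 → ℝ} (hη : IsTest η) (i : Fin 3) : IsTest (pd i η) :=
  ⟨(hη.1.fderiv_right (m := ∞) (by simp)).clm_apply contDiff_const, hη.compact_partial _⟩

/-- The convolution `∫ η(x - t) f(t) dt`. -/
noncomputable def mollify (f η : E3 → ℝ) : E3 → ℝ :=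
  f ⋆[ContinuousLinearMap.lsmul ℝ ℝ, volume] η

lemma mollify_apply (f η : E3 → ℝ) (x : E3) : mollify f η x = ∫ t, f t * η (x - t) := rfl

lemma continuous_mollify {f η : E3 → ℝ} (hf : LocallyIntegrable f) (hη : IsTest η) :
    Continuous (mollify f η) :=
  (hη.2.contDiff_convolution_right (n := 0) (ContinuousLinearMap.lsmul ℝ ℝ) hf
    (hη.1.of_le (by simp))).continuous

lemma hasDerivAt_mollify {f η : E3 → ℝ} (hf : LocallyIntegrable f) (hη : IsTest η) (i : Fin 3)
    (x : E3) (s : ℝ) :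
    HasDerivAt (fun s : ℝ => mollify f η (x + s • basisVec i))
      (mollify f (pd i η) (x + s • basisVec i)) s := by
  have h := hη.2.hasFDerivAt_convolution_right (ContinuousLinearMap.lsmul ℝ ℝ) hf
    (hη.1.of_le (by simp)) (x + s • basisVec i)
  have h1 : HasDerivAt (fun s : ℝ => x + s • basisVec i) (basisVec i) s := by
    simpa using ((hasDerivAt_id s).smul_const (basisVec i)).const_add x
  have h2 := h.comp_hasDerivAt s h1
  rwa [convolution_precompR_apply _ hf (hη.2.fderiv (𝕜 := ℝ))
    (hη.1.continuous_fderiv (by simp))] at h2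

/-- A maximum on a line cannot have positive second derivative. -/
lemma deriv_deriv_nonpos_of_max {h : ℝ → ℝ} (hc : Continuous h) {s : ℝ} (hm : ∀ t, h t ≤ h s) :
    deriv (deriv h) s ≤ 0 := by
  by_contra! hpos
  have hmax : IsLocalMax h s := Eventually.of_forall hm
  have hmin := isLocalMin_of_deriv_deriv_pos hpos hmax.deriv_eq_zero hc.continuousAt
  have hconst : h =ᶠ[𝓝 s] fun _ => h s := by
    filter_upwards [hmin] with t ht
    exact le_antisymm (hm t) ht
  have h1 : deriv h =ᶠ[𝓝 s] deriv (fun _ => h s) := hconst.deriv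
  rw [h1.deriv_eq] at hpos
  simp at hpos

lemma integral_mul_le_eLpNorm {g k : E3 → ℝ} (hg : MemLp g 2) (hk : MemLp k 2) :
    ∫ t, g t * k t ≤ (eLpNorm g 2 volume).toReal * (eLpNorm k 2 volume).toReal := by
  have e2 : ∫ t, g t * k t = ⟪hg.toLp, hk.toLp⟫ := by
    rw [L2.inner_def]
    refine integral_congr_ae ?_
    filter_upwards [hg.coeFn_toLp, hk.coeFn_toLp] with t h1 h2
    rw [h1, h2]
    simp [mul_comm]
  have e3 := real_inner_le_norm hg.toLp hk.toLp
  rw [Lp.norm_toLp, Lp.norm_toLp] at e3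
  rw [e2]
  exact e3

lemma mollify_sub_le {f f' η : E3 → ℝ} (hf : MemLp f 2) (hf' : MemLp f' 2) (hη : IsTest η)
    (x : E3) : mollify f η x - mollify f' η x
      ≤ (eLpNorm (f - f') 2 volume).toReal * (eLpNorm η 2 volume).toReal := by
  have hη2 : MemLp η 2 (volume : Measure E3) := hη.1.continuous.memLp_of_hasCompactSupport hη.2
  have hmp : MeasurePreserving (fun t : E3 => x - t) volume volume :=
    Measure.measurePreserving_sub_left volume x
  have hηx : MemLp (fun t => η (x - t)) 2 (volume : Measure E3) := hη2.comp_measurePreserving hmp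
  have hηxn : eLpNorm (fun t => η (x - t)) 2 volume = eLpNorm η 2 volume :=
    eLpNorm_comp_measurePreserving hη2.aestronglyMeasurable hmp
  have i1 : Integrable (fun t => f t * η (x - t)) := hf.integrable_mul hηx
  have i2 : Integrable (fun t => f' t * η (x - t)) := hf'.integrable_mul hηx
  have h := integral_mul_le_eLpNorm (hf.sub hf') hηx
  rw [hηxn] at h
  refine le_of_eq_of_le ?_ h
  rw [mollify_apply, mollify_apply, ← integral_sub i1 i2]
  refine integral_congr_ae (Eventually.of_forall fun t => ?_)
  simp only [Pi.sub_apply, sub_mul]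

/-- Mollifications of square integrable functions vanish at infinity. -/
lemma mollify_eventually_lt {f η : E3 → ℝ} (hf : MemLp f 2) (hη : IsTest η) {c : ℝ} (hc : 0 < c) :
    ∀ᶠ x in cocompact E3, mollify f η x < c := by
  -- `f` is close in `L²` to a compactly supported `f'`, whose mollification has compact support
  have hN : 0 ≤ (eLpNorm η 2 volume).toReal := ENNReal.toReal_nonneg
  set N := (eLpNorm η 2 volume).toReal with hNdef
  have hδ0 : 0 < c / (N + 1) := by positivity
  obtain ⟨f', hf'c, hf's, hf'n⟩ := hf.exist_eLpNorm_sub_le (by simp) (by norm_num) hδ0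
  have hf'2 : MemLp f' 2 (volume : Measure E3) :=
    hf's.continuous.memLp_of_hasCompactSupport hf'c
  have hsupp : HasCompactSupport (mollify f' η) :=
    HasCompactSupport.convolution (ContinuousLinearMap.lsmul ℝ ℝ) hf'c hη.2
  filter_upwards [hsupp.isCompact.compl_mem_cocompact] with x hx
  have hx0 : mollify f' η x = 0 := image_eq_zero_of_notMem_tsupport hx
  have e4 : (eLpNorm (f - f') 2 volume).toReal ≤ c / (N + 1) :=
    ENNReal.toReal_le_of_le_ofReal hδ0.le hf'n
  have h := mollify_sub_le hf hf'2 hη x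
  rw [hx0, sub_zero] at h
  calc _ ≤ (eLpNorm (f - f') 2 volume).toReal * N := h
    _ ≤ c / (N + 1) * N := by gcongr
    _ < c := by rw [div_mul_eq_mul_div, div_lt_iff₀ (by positivity)]; nlinarith

/-- The maximum principle for mollifications that solve `Δg = g`: at a positive maximum all second
derivatives `∂_i²g` are nonpositive, so that `g = Δg ≤ 0` there. -/
lemma mollify_nonpos {f η : E3 → ℝ} (hf : MemLp f 2) (hη : IsTest η)
    (h : ∀ x, ∑ i, mollify f (pd i (pd i η)) x = mollify f η x) (x : E3) : mollify f η x ≤ 0 := by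
  by_contra! hx
  have hl : LocallyIntegrable f := hf.locallyIntegrable (by norm_num)
  have hcont := continuous_mollify hl hη
  obtain ⟨z, hz⟩ := hcont.exists_forall_ge' x
    ((mollify_eventually_lt hf hη hx).mono fun y hy => hy.le)
  have h2 : ∀ i : Fin 3, mollify f (pd i (pd i η)) z ≤ 0 := by
    intro i
    have hd : deriv (fun s : ℝ => mollify f η (z + s • basisVec i))
        = fun s => mollify f (pd i η) (z + s • basisVec i) :=
      funext fun s => (hasDerivAt_mollify hl hη i z s).deriv
    have hdd := (hasDerivAt_mollify hl (hη.pd i) i z 0).deriv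
    rw [← hd] at hdd
    have := deriv_deriv_nonpos_of_max (h := fun s : ℝ => mollify f η (z + s • basisVec i)) (s := 0)
      (by fun_prop) (fun t => by simpa using hz _)
    rw [hdd] at this
    simpa using this
  have h3 := Finset.sum_nonpos (s := Finset.univ) fun i _ => h2 i
  rw [h z] at h3
  linarith [hz x]

lemma pd_comp_const_sub {η : E3 → ℝ} (hη : IsTest η) (x : E3) (i : Fin 3) :
    pd i (fun t => η (x - t)) = fun t => - pd i η (x - t) := by
  funext t
  have h1 : HasFDerivAt η (fderiv ℝ η (x - t)) (x - t) :=
    ((hη.1.differentiable (by simp)) _).hasFDerivAt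
  have h2 : HasFDerivAt (fun t : E3 => x - t) (-ContinuousLinearMap.id ℝ E3) t := by
    simpa using (hasFDerivAt_id t).const_sub x
  have h3 := (h1.comp t h2).fderiv
  simp only [Function.comp_def] at h3
  simp [pd, h3]

lemma IsTest.comp_const_sub {η : E3 → ℝ} (hη : IsTest η) (x : E3) :
    IsTest (fun t => η (x - t)) :=
  ⟨hη.1.comp (contDiff_const.sub contDiff_id),
    hη.2.comp_homeomorph (Homeomorph.subLeft x)⟩

lemma IsTest.neg {η : E3 → ℝ} (hη : IsTest η) : IsTest (fun t => - η t) :=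
  ⟨hη.1.neg, hη.2.neg⟩

lemma pd_neg (η : E3 → ℝ) (i : Fin 3) : pd i (fun t => - η t) = fun t => - pd i η t := by
  funext t
  simp [pd, fderiv_fun_neg]

lemma pd_pd_comp_const_sub {η : E3 → ℝ} (hη : IsTest η) (x : E3) (i : Fin 3) :
    pd i (pd i (fun t => η (x - t))) = fun t => pd i (pd i η) (x - t) := by
  rw [pd_comp_const_sub hη, pd_neg, pd_comp_const_sub (hη.pd i)]
  simp

/-- A square integrable function with `Δf = f` in the sense of distributions vanishes: its
mollifications are smooth solutions that vanish at infinity. -/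
theorem ae_eq_zero_of_laplacian_eq_self {f : E3 → ℝ} (hf : MemLp f 2)
    (h : ∀ ψ : E3 → ℝ, IsTest ψ → ∑ i, ∫ x, pd i (pd i ψ) x * f x = ∫ x, ψ x * f x) :
    f =ᵐ[volume] 0 := by
  have key : ∀ η : E3 → ℝ, IsTest η → ∀ x,
      ∑ i, mollify f (pd i (pd i η)) x = mollify f η x := by
    intro η hη x
    have := h _ (hη.comp_const_sub x)
    simp only [pd_pd_comp_const_sub hη] at this
    simpa only [mollify_apply, mul_comm] using this
  have hle : ∀ η : E3 → ℝ, IsTest η → ∀ x, mollify f η x ≤ 0 := fun η hη x =>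
    mollify_nonpos hf hη (key η hη) x
  refine ae_eq_zero_of_integral_contDiff_smul_eq_zero (hf.locallyIntegrable (by norm_num)) ?_
  -- evaluating at `0` the mollification by the reflection of `η` gives the integral against `η`
  have hle' : ∀ η : E3 → ℝ, IsTest η → ∫ x, η x * f x ≤ 0 := by
    intro η hη
    have h1 := hle _ (hη.comp_const_sub 0) 0
    simpa [mollify_apply, mul_comm] using h1
  intro g hg hgc
  refine le_antisymm (hle' g ⟨hg, hgc⟩) ?_
  have := hle' _ (IsTest.neg ⟨hg, hgc⟩)
  simp only [neg_mul, integral_neg] at this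
  simpa using this

end Uniqueness

/-! ### Test fields in `L²` and in `H¹` -/

section TestFields

/-- Smooth compactly supported vector fields on `Σ`. -/
def IsTestField (F : E3 → E3) : Prop := ContDiff ℝ ∞ F ∧ HasCompactSupport F

/-- The partial derivative `∂_j F` of a vector field. -/
noncomputable def pdv (j : Fin 3) (F : E3 → E3) : E3 → E3 := fun x => fderiv ℝ F x (basisVec j)

lemma IsTestField.memLp {F : E3 → E3} (hF : IsTestField F) :
    MemLp F 2 (volume : Measure E3) :=
  hF.1.continuous.memLp_of_hasCompactSupport hF.2

/-- The class in `L²` of a test field. -/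
noncomputable def testL2 {F : E3 → E3} (hF : IsTestField F) : L2 E3 := hF.memLp.toLp

lemma testL2_ae {F : E3 → E3} (hF : IsTestField F) : (testL2 hF : E3 → E3) =ᵐ[volume] F :=
  hF.memLp.coeFn_toLp

lemma IsTestField.coord {F : E3 → E3} (hF : IsTestField F) (i : Fin 3) :
    IsTest (fun x => F x i) :=
  ⟨(EuclideanSpace.proj i : E3 →L[ℝ] ℝ).contDiff.comp hF.1,
    hF.2.comp_left (g := fun v : E3 => v i) rfl⟩

lemma IsTestField.pdv {F : E3 → E3} (hF : IsTestField F) (j : Fin 3) : IsTestField (pdv j F) :=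
  ⟨(hF.1.fderiv_right (m := ∞) (by simp)).clm_apply contDiff_const,
    hF.2.fderiv_apply (𝕜 := ℝ) (basisVec j)⟩

lemma pdv_coord {F : E3 → E3} (hF : IsTestField F) (j i : Fin 3) (x : E3) :
    pdv j F x i = pd j (fun x => F x i) x := by
  have h := (EuclideanSpace.proj i : E3 →L[ℝ] ℝ).hasFDerivAt.comp x
    ((hF.1.differentiable (by simp)) x).hasFDerivAt
  have h2 : fderiv ℝ (fun x => F x i) x
      = (EuclideanSpace.proj i : E3 →L[ℝ] ℝ).comp (fderiv ℝ F x) := h.fderiv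
  simp [pd, h2, Maxwell.pdv]

lemma IsTest.memLp {ψ : E3 → ℝ} (hψ : IsTest ψ) : MemLp ψ 2 (volume : Measure E3) :=
  hψ.1.continuous.memLp_of_hasCompactSupport hψ.2

lemma coord_memLp (g : L2 E3) (i : Fin 3) : MemLp (fun x => g x i) 2 (volume : Measure E3) :=
  (memLp_congr_ae (coord_ae i g)).1 (Lp.memLp _)

lemma IsTest.integrable_mul_coord {ψ : E3 → ℝ} (hψ : IsTest ψ) (g : L2 E3) (i : Fin 3) :
    Integrable (fun x => ψ x * g x i) :=
  hψ.memLp.integrable_mul (coord_memLp g i)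

lemma integrable_coord_mul_coord (f g : L2 E3) (i j : Fin 3) :
    Integrable (fun x => f x i * g x j) :=
  (coord_memLp f i).integrable_mul (coord_memLp g j)

lemma inner_L2 (f g : L2 E3) : ⟪f, g⟫ = ∑ i, ∫ x, f x i * g x i := by
  rw [L2.inner_def, ← integral_finsetSum _ fun i _ => integrable_coord_mul_coord f g i i]
  refine integral_congr_ae (Eventually.of_forall fun x => ?_)
  simp [PiLp.inner_apply, mul_comm]

lemma inner_testL2 {F : E3 → E3} (hF : IsTestField F) (g : L2 E3) :
    ⟪testL2 hF, g⟫ = ∑ i, ∫ x, F x i * g x i := by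
  rw [inner_L2]
  refine Finset.sum_congr rfl fun i _ => integral_congr_ae ?_
  filter_upwards [testL2_ae hF] with x hx
  rw [hx]

lemma dense_testL2 : Dense {f : L2 E3 | ∃ (F : E3 → E3) (hF : IsTestField F), f = testL2 hF} := by
  refine (Lp.dense_hasCompactSupport_contDiff (F := E3) (μ := (volume : Measure E3)) (p := 2)
    (by simp)).mono ?_
  rintro f ⟨F, hf, hFc, hFs⟩
  exact ⟨F, ⟨hFs, hFc⟩, Lp.ext (hf.trans (testL2_ae ⟨hFs, hFc⟩).symm)⟩

lemma isWeakPartial_coord {j : Fin 3} {f g : L2 E3} (h : IsWeakPartial j f g) {ψ : E3 → ℝ}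
    (hψ : IsTest ψ) (i : Fin 3) : ∫ x, pd j ψ x * f x i = - ∫ x, ψ x * g x i := by
  have h1 := congrArg (EuclideanSpace.proj i : E3 →L[ℝ] ℝ) (h ψ hψ)
  rw [map_neg, ← ContinuousLinearMap.integral_comp_comm _ (hψ.integrable_partial_smul _ f),
    ← ContinuousLinearMap.integral_comp_comm _ (hψ.integrable_smul g)] at h1
  simpa [pd] using h1

lemma IsTestField.smul_const {ψ : E3 → ℝ} (hψ : IsTest ψ) (v : E3) :
    IsTestField (fun x => ψ x • v) :=
  ⟨hψ.1.smul contDiff_const, hψ.2.smul_right (f' := fun _ => v)⟩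

/-- The weak derivative tested with vector fields, as an identity of inner products in `L²`. -/
lemma isWeakPartial_iff_inner {j : Fin 3} {f g : L2 E3} :
    IsWeakPartial j f g ↔ ∀ (F : E3 → E3) (hF : IsTestField F),
      ⟪testL2 (hF.pdv j), f⟫ = - ⟪testL2 hF, g⟫ := by
  constructor
  · intro h F hF
    rw [inner_testL2, inner_testL2, ← Finset.sum_neg_distrib]
    refine Finset.sum_congr rfl fun i _ => ?_
    rw [← isWeakPartial_coord h (hF.coord i)]
    simp only [pdv_coord hF]
  · intro h ψ hψ
    have key : ∀ (χ : E3 → ℝ) (_ : IsTest χ) (k : L2 E3) (i : Fin 3),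
        (∫ x, χ x • k x) i = ∫ x, χ x * k x i := by
      intro χ hχ k i
      have := ContinuousLinearMap.integral_comp_comm (EuclideanSpace.proj i : E3 →L[ℝ] ℝ)
        (hχ.integrable_smul k)
      simpa using this.symm
    ext i
    have h1 := h _ (IsTestField.smul_const hψ (basisVec i))
    rw [inner_testL2, inner_testL2] at h1
    have e1 : ∀ x l, (fun x => ψ x • basisVec i) x l = if l = i then ψ x else 0 := by
      intro x l
      by_cases hl : l = i <;> simp [basisVec, hl]
    have e2 : ∀ x l, Maxwell.pdv j (fun x => ψ x • basisVec i) x l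
        = if l = i then pd j ψ x else 0 := by
      intro x l
      rw [pdv_coord (IsTestField.smul_const hψ (basisVec i))]
      by_cases hl : l = i
      · subst hl; simp only [if_true]; congr 1; funext y; simp [basisVec]
      · simp only [hl, if_false]
        have : (fun x => (ψ x • basisVec i) l) = fun _ => (0 : ℝ) := by
          funext y; simp [basisVec, hl]
        rw [this]; simp [pd]
    simp only [e1, e2, ite_mul, zero_mul] at h1
    rw [Finset.sum_eq_single i (by intro l _ hl; simp [hl]) (by simp),
      Finset.sum_eq_single i (by intro l _ hl; simp [hl]) (by simp)] at h1
    simp only [if_true] at h1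
    change (∫ x, pd j ψ x • f x) i = (- ∫ x, ψ x • g x) i
    rw [PiLp.neg_apply, key _ (hψ.pd j), key _ hψ, h1]

lemma isClosed_H1 : IsClosed (H1 : Set Jet) := by
  have : (H1 : Set Jet) = ⋂ (j : Fin 3) (F : E3 → E3) (hF : IsTestField F),
      {u : Jet | ⟪testL2 (hF.pdv j), u none⟫ = - ⟪testL2 hF, u (some j)⟫} := by
    ext u
    simp only [Set.mem_iInter, Set.mem_ofPred_eq]
    exact forall_congr' fun j => isWeakPartial_iff_inner
  rw [this]
  refine isClosed_iInter fun j => isClosed_iInter fun F => isClosed_iInter fun hF => ?_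
  have hc : ∀ o : Option (Fin 3), Continuous fun u : Jet => u o := fun o =>
    (PiLp.proj 2 (fun _ : Option (Fin 3) => L2 E3) o : Jet →L[ℝ] L2 E3).continuous
  exact isClosed_eq (continuous_const.inner (hc _)) (continuous_const.inner (hc _)).neg

instance : CompleteSpace H1 := isClosed_H1.completeSpace_coe

instance : CompleteSpace K := gradH2.isClosed_topologicalClosure.completeSpace_coe

/-- The derivative `∂_j : H¹(Σ) → L²(Σ)`. -/
noncomputable def derL (j : Fin 3) : H1 →L[ℝ] L2 E3 :=
  (PiLp.proj 2 (fun _ : Option (Fin 3) => L2 E3) (some j)).comp H1.subtypeL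

lemma derL_apply (j : Fin 3) (a : H1) : derL j a = der a j := rfl

lemma fldL_apply (a : H1) : fldL a = fld a := rfl

lemma isWeakPartial_fld (a : H1) (j : Fin 3) : IsWeakPartial j (fld a) (der a j) := a.2 j

lemma inner_H1 (a b : H1) : ⟪a, b⟫ = ⟪fld a, fld b⟫ + ∑ j, ⟪der a j, der b j⟫ := by
  change ⟪(a : Jet), (b : Jet)⟫ = _
  rw [PiLp.inner_apply, Fintype.sum_option]
  rfl

lemma isWeakPartial_unique {j : Fin 3} {f g g' : L2 E3} (h : IsWeakPartial j f g)
    (h' : IsWeakPartial j f g') : g = g' := by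
  refine Lp.ext (ae_eq_of_integral_contDiff_smul_eq (L2_locallyIntegrable g)
    (L2_locallyIntegrable g') fun ψ hψ hψc => ?_)
  rw [← neg_inj, ← h ψ ⟨hψ, hψc⟩, ← h' ψ ⟨hψ, hψc⟩]

lemma fld_injective : Function.Injective fld := by
  intro a b h
  refine Subtype.ext (PiLp.ext fun o => ?_)
  cases o with
  | none => exact h
  | some j =>
    exact isWeakPartial_unique (isWeakPartial_fld a j) (h ▸ isWeakPartial_fld b j)

lemma integral_pd_mul {ψ χ : E3 → ℝ} (hψ : IsTest ψ) (hχ : IsTest χ) (j : Fin 3) :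
    ∫ x, pd j ψ x * χ x = - ∫ x, ψ x * pd j χ x := by
  have i1 : Integrable (fun x => pd j ψ x * χ x) := (hψ.pd j).memLp.integrable_mul hχ.memLp
  have i2 : Integrable (fun x => ψ x * pd j χ x) := hψ.memLp.integrable_mul (hχ.pd j).memLp
  have i3 : Integrable (fun x => ψ x * χ x) := hψ.memLp.integrable_mul hχ.memLp
  have := integral_mul_fderiv_eq_neg_fderiv_mul_of_integrable i1 i2 i3
    (fun x _ => hψ.1.differentiable (by simp) x) (fun x _ => hχ.1.differentiable (by simp) x)
  simp only [pd] at this ⊢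
  rw [this, neg_neg]

lemma isWeakPartial_testL2 {F : E3 → E3} (hF : IsTestField F) (j : Fin 3) :
    IsWeakPartial j (testL2 hF) (testL2 (hF.pdv j)) := by
  rw [isWeakPartial_iff_inner]
  intro G hG
  rw [inner_testL2, inner_testL2, ← Finset.sum_neg_distrib]
  refine Finset.sum_congr rfl fun i _ => ?_
  have e1 : ∫ x, Maxwell.pdv j G x i * testL2 hF x i
      = ∫ x, pd j (fun x => G x i) x * F x i := by
    refine integral_congr_ae ?_
    filter_upwards [testL2_ae hF] with x hx
    rw [hx, pdv_coord hG]
  have e2 : ∫ x, G x i * testL2 (hF.pdv j) x i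
      = ∫ x, G x i * pd j (fun x => F x i) x := by
    refine integral_congr_ae ?_
    filter_upwards [testL2_ae (hF.pdv j)] with x hx
    rw [hx, pdv_coord hF]
  rw [e1, e2]
  exact integral_pd_mul (hG.coord i) (hF.coord i) j

/-- The point of `H¹(Σ)` with a prescribed field and prescribed weak derivatives. -/
noncomputable def mkH1 (f : L2 E3) (g : Fin 3 → L2 E3) (h : ∀ j, IsWeakPartial j f (g j)) : H1 :=
  ⟨WithLp.toLp 2 fun o => o.elim f g, h⟩

lemma der_mkH1 {f : L2 E3} {g : Fin 3 → L2 E3} (h : ∀ j, IsWeakPartial j f (g j)) (j : Fin 3) :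
    der (mkH1 f g h) j = g j := rfl

/-- The point of `H¹(Σ)` given by a test field. -/
noncomputable def testH1 {F : E3 → E3} (hF : IsTestField F) : H1 :=
  mkH1 (testL2 hF) (fun j => testL2 (hF.pdv j)) (isWeakPartial_testL2 hF)

lemma inner_testH1 {F : E3 → E3} (hF : IsTestField F) (a : H1) :
    ⟪testH1 hF, a⟫ = ⟪testL2 hF, fld a⟫ + ∑ j, ⟪testL2 (hF.pdv j), der a j⟫ := inner_H1 _ _

lemma inner_testH1_eq_laplacian {F : E3 → E3} (hF : IsTestField F) (a : H1) :
    ⟪testH1 hF, a⟫ = ⟪testL2 hF, fld a⟫ - ∑ j, ⟪testL2 ((hF.pdv j).pdv j), fld a⟫ := by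
  rw [inner_testH1, sub_eq_add_neg, ← Finset.sum_neg_distrib]
  congr 1
  refine Finset.sum_congr rfl fun j _ => ?_
  rw [isWeakPartial_iff_inner.1 (isWeakPartial_fld a j) _ (hF.pdv j), neg_neg]

lemma pdv_smul_basisVec {ψ : E3 → ℝ} (hψ : IsTest ψ) (i j : Fin 3) :
    pdv j (fun x => ψ x • basisVec i) = fun x => pd j ψ x • basisVec i := by
  funext x
  have h := ((hψ.1.differentiable (by simp)) x).hasFDerivAt.smul_const (basisVec i)
  rw [pdv, h.fderiv]; rfl

lemma inner_testL2_smul_basisVec {ψ : E3 → ℝ} (i : Fin 3) {F : E3 → E3}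
    (hF : IsTestField F) (h : F = fun x => ψ x • basisVec i) (g : L2 E3) :
    ⟪testL2 hF, g⟫ = ∫ x, ψ x * g x i := by
  rw [inner_testL2, Finset.sum_eq_single i]
  · simp [h, basisVec]
  · intro l _ hl
    simp [h, basisVec, hl]
  · simp

/-- Test fields are dense in `H¹(Σ)`: a field orthogonal to all of them solves `Δa = a`. -/
lemma eq_zero_of_inner_testH1 {a : H1}
    (h : ∀ (F : E3 → E3) (hF : IsTestField F), ⟪testH1 hF, a⟫ = 0) : a = 0 := by
  have key : ∀ i : Fin 3, (fun x => fld a x i) =ᵐ[volume] 0 := by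
    intro i
    refine ae_eq_zero_of_laplacian_eq_self (coord_memLp (fld a) i) fun ψ hψ => ?_
    have hF := IsTestField.smul_const hψ (basisVec i)
    have h1 := h _ hF
    rw [inner_testH1_eq_laplacian, inner_testL2_smul_basisVec i hF rfl, sub_eq_zero] at h1
    rw [h1]
    refine Finset.sum_congr rfl fun j _ => ?_
    rw [inner_testL2_smul_basisVec i]
    rw [pdv_smul_basisVec hψ, pdv_smul_basisVec (hψ.pd j)]
  apply fld_injective
  refine Lp.ext ?_
  have h0 : (fld 0 : E3 → E3) =ᵐ[volume] 0 := Lp.coeFn_zero E3 2 volume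
  filter_upwards [key 0, key 1, key 2, h0] with x h0 h1 h2 h3
  rw [h3]
  ext i
  fin_cases i
  exacts [h0, h1, h2]

lemma dense_span_testH1 : Dense
    (Submodule.span ℝ {a : H1 | ∃ (F : E3 → E3) (hF : IsTestField F), a = testH1 hF} : Set H1) := by
  rw [Submodule.dense_iff_topologicalClosure_eq_top, Submodule.topologicalClosure_eq_top_iff,
    Submodule.eq_bot_iff]
  intro a ha
  refine eq_zero_of_inner_testH1 fun F hF => ?_
  exact (Submodule.mem_orthogonal _ _).1 ha _ (Submodule.subset_span ⟨F, hF, rfl⟩)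

lemma clm_eq_zero_of_testH1 {W : Type*} [NormedAddCommGroup W] [NormedSpace ℝ W] (ℓ : H1 →L[ℝ] W)
    (h : ∀ (F : E3 → E3) (hF : IsTestField F), ℓ (testH1 hF) = 0) (a : H1) : ℓ a = 0 := by
  have : ℓ = 0 := ContinuousLinearMap.ext_on dense_span_testH1 (by
    rintro _ ⟨F, hF, rfl⟩
    simpa using h F hF)
  rw [this]; rfl

end TestFields

/-! ### The Helmholtz splitting of `H¹(Σ)` -/

section Helmholtz

/-- The gradient field `∂ψ`. -/
noncomputable def gradTest (ψ : E3 → ℝ) : E3 → E3 := fun x => ∑ i, pd i ψ x • basisVec i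

lemma gradTest_apply (ψ : E3 → ℝ) (x : E3) (i : Fin 3) : gradTest ψ x i = pd i ψ x := by
  fin_cases i <;> simp [gradTest, basisVec, Fin.sum_univ_three]

lemma IsTest.gradTest {ψ : E3 → ℝ} (hψ : IsTest ψ) : IsTestField (gradTest ψ) := by
  have h0 := IsTestField.smul_const (hψ.pd 0) (basisVec 0)
  have h1 := IsTestField.smul_const (hψ.pd 1) (basisVec 1)
  have h2 := IsTestField.smul_const (hψ.pd 2) (basisVec 2)
  have e : Maxwell.gradTest ψ = (((fun x => Maxwell.pd 0 ψ x • basisVec 0)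
      + fun x => Maxwell.pd 1 ψ x • basisVec 1) + fun x => Maxwell.pd 2 ψ x • basisVec 2) := by
    funext x; simp [Maxwell.gradTest, Fin.sum_univ_three]
  rw [e]
  exact ⟨(h0.1.add h1.1).add h2.1, (h0.2.add h1.2).add h2.2⟩

lemma fderiv_eq_sum_pd (ψ : E3 → ℝ) (x v : E3) : fderiv ℝ ψ x v = ∑ i, pd i ψ x * v i := by
  conv_lhs => rw [sum_basisVec v]
  rw [map_sum]
  refine Finset.sum_congr rfl fun i _ => ?_
  rw [map_smul, smul_eq_mul, mul_comm]; rfl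

lemma inner_testL2_gradTest {ψ : E3 → ℝ} (hψ : IsTest ψ) (p : L2 E3) :
    ⟪testL2 hψ.gradTest, p⟫ = ∫ x, fderiv ℝ ψ x (p x) := by
  rw [inner_testL2, ← integral_finsetSum]
  · simp only [fderiv_eq_sum_pd, gradTest_apply]
  · intro i _
    simp only [gradTest_apply]
    exact (hψ.pd i).integrable_mul_coord p i

lemma mem_Hdiv0_iff_inner {p : L2 E3} :
    p ∈ Hdiv0 ↔ ∀ (ψ : E3 → ℝ) (hψ : IsTest ψ), ⟪testL2 hψ.gradTest, p⟫ = 0 :=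
  forall₂_congr fun ψ hψ => by rw [inner_testL2_gradTest hψ p]

lemma pd_comm {ψ : E3 → ℝ} (hψ : IsTest ψ) (i j : Fin 3) : pd i (pd j ψ) = pd j (pd i ψ) := by
  funext x
  have hd : DifferentiableAt ℝ (fderiv ℝ ψ) x :=
    (hψ.1.fderiv_right (m := ∞) (by simp)).differentiable (by simp) x
  have key : ∀ k l : Fin 3, pd k (pd l ψ) x
      = fderiv ℝ (fderiv ℝ ψ) x (basisVec k) (basisVec l) := by
    intro k l
    have h := (hd.hasFDerivAt.clm_apply (hasFDerivAt_const (basisVec l) x)).fderiv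
    have h' := congrArg (fun A : E3 →L[ℝ] ℝ => A (basisVec k)) h
    simp only [ContinuousLinearMap.comp_zero, zero_add] at h'
    exact h'
  rw [key, key]
  exact (hψ.1.contDiffAt.isSymmSndFDerivAt (by
    simpa using WithTop.coe_le_coe.2 (le_top : (2 : ℕ∞) ≤ ⊤))) _ _

lemma pdv_gradTest {ψ : E3 → ℝ} (hψ : IsTest ψ) (j : Fin 3) :
    pdv j (gradTest ψ) = gradTest (pd j ψ) := by
  funext x
  ext i
  rw [pdv_coord hψ.gradTest, gradTest_apply]
  simp only [gradTest_apply]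
  exact congrFun (pd_comm hψ j i) x

lemma testL2_congr {F G : E3 → E3} (hF : IsTestField F) (hG : IsTestField G) (h : F = G) :
    testL2 hF = testL2 hG := by
  subst h; rfl

lemma inner_testH1_gradTest {ψ : E3 → ℝ} (hψ : IsTest ψ) (a : H1) :
    ⟪testH1 hψ.gradTest, a⟫ = ⟪testL2 hψ.gradTest, fld a⟫
      - ∑ j, ⟪testL2 ((hψ.pd j).pd j).gradTest, fld a⟫ := by
  rw [inner_testH1_eq_laplacian]
  congr 1
  refine Finset.sum_congr rfl fun j _ => ?_
  rw [testL2_congr _ ((hψ.pd j).pd j).gradTest]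
  rw [pdv_gradTest hψ, pdv_gradTest (hψ.pd j)]

lemma mem_H1div0 {a : H1} : a ∈ H1div0 ↔ fld a ∈ Hdiv0 := Iff.rfl

/-- The weak divergence of a field in `H¹(Σ)` is `∑ᵢ (∂ᵢ a)ᵢ`. -/
lemma inner_gradTest_fld {ψ : E3 → ℝ} (hψ : IsTest ψ) (a : H1) :
    ⟪testL2 hψ.gradTest, fld a⟫ = - ∫ x, ψ x * ∑ i, der a i x i := by
  have e : ∀ x, ψ x * ∑ i, der a i x i = ∑ i, ψ x * der a i x i := fun x => Finset.mul_sum _ _ _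
  simp only [e]
  rw [inner_testL2, integral_finsetSum _ fun i _ => hψ.integrable_mul_coord (der a i) i,
    ← Finset.sum_neg_distrib]
  refine Finset.sum_congr rfl fun i _ => ?_
  simp only [gradTest_apply]
  exact isWeakPartial_coord (isWeakPartial_fld a i) hψ i

/-- A field of class `H¹` is divergence free if and only if it is orthogonal in `H¹(Σ)` to the
gradients of test functions: for `d = div a`, orthogonality means `Δd = d`. -/
lemma mem_H1div0_iff_inner {a : H1} :
    a ∈ H1div0 ↔ ∀ (ψ : E3 → ℝ) (hψ : IsTest ψ), ⟪testH1 hψ.gradTest, a⟫ = 0 := by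
  constructor
  · intro h ψ hψ
    have h' := mem_Hdiv0_iff_inner.1 (mem_H1div0.1 h)
    rw [inner_testH1_gradTest hψ, h' ψ hψ, Finset.sum_eq_zero fun j _ => h' _ ((hψ.pd j).pd j),
      sub_zero]
  · intro h
    have hd : (fun x => ∑ i, der a i x i) =ᵐ[volume] 0 := by
      refine ae_eq_zero_of_laplacian_eq_self
        (memLp_finsetSum _ fun i _ => coord_memLp (der a i) i) fun ψ hψ => ?_
      have h1 := h ψ hψ
      rw [inner_testH1_gradTest hψ, inner_gradTest_fld hψ] at h1
      rw [Finset.sum_congr rfl fun j _ => inner_gradTest_fld ((hψ.pd j).pd j) a,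
        Finset.sum_neg_distrib] at h1
      linarith
    refine mem_H1div0.2 (mem_Hdiv0_iff_inner.2 fun ψ hψ => ?_)
    rw [inner_gradTest_fld hψ, neg_eq_zero]
    refine integral_eq_zero_of_ae ?_
    filter_upwards [hd] with x hx
    rw [hx]; simp

lemma testH1_gradTest_mem_gradH2 {ψ : E3 → ℝ} (hψ : IsTest ψ) :
    testH1 hψ.gradTest ∈ gradH2 := by
  refine ⟨hψ.memLp.toLp, fun j χ hχ => ?_⟩
  have e1 : ∫ x, fderiv ℝ χ x (basisVec j) • (hψ.memLp.toLp : E3 → ℝ) x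
      = ∫ x, pd j χ x * ψ x := by
    refine integral_congr_ae ?_
    filter_upwards [hψ.memLp.coeFn_toLp] with x hx
    rw [hx]; rfl
  have e2 : ∫ x, χ x • fld (testH1 hψ.gradTest) x j = ∫ x, χ x * pd j ψ x := by
    refine integral_congr_ae ?_
    filter_upwards [testL2_ae hψ.gradTest] with x hx
    have : fld (testH1 hψ.gradTest) x = gradTest ψ x := hx
    rw [this, gradTest_apply]; rfl
  rw [e1, e2]
  exact integral_pd_mul hχ hψ j

lemma gradH2_le_K : gradH2 ≤ K := gradH2.le_topologicalClosure

/-- The continuous functional `u ↦ ∫ ∑_j (∂_j u)_i p^j` on `H¹(Σ)`. -/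
noncomputable def coordGradPairing (i : Fin 3) (p : L2 E3) : H1 →L[ℝ] ℝ :=
  ∑ j, (innerSL ℝ (((EuclideanSpace.proj j : E3 →L[ℝ] ℝ).smulRight (basisVec i)).compLpL 2 volume
    p)).comp (derL j)

lemma coordGradPairing_apply (i : Fin 3) (p : L2 E3) (u : H1) :
    coordGradPairing i p u = ∑ j, ∫ x, p x j * der u j x i := by
  simp only [coordGradPairing, _root_.sum_apply, ContinuousLinearMap.comp_apply,
    innerSL_apply_apply, derL_apply]
  refine Finset.sum_congr rfl fun j _ => ?_
  rw [inner_L2, Finset.sum_eq_single i]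
  · refine integral_congr_ae ?_
    filter_upwards [ContinuousLinearMap.coeFn_compLpL (p := 2) (μ := (volume : Measure E3))
      ((EuclideanSpace.proj j : E3 →L[ℝ] ℝ).smulRight (basisVec i)) p] with x hx
    rw [hx]; simp [basisVec]
  · intro l _ hl
    refine integral_eq_zero_of_ae ?_
    filter_upwards [ContinuousLinearMap.coeFn_compLpL (p := 2) (μ := (volume : Measure E3))
      ((EuclideanSpace.proj j : E3 →L[ℝ] ℝ).smulRight (basisVec i)) p] with x hx
    rw [hx]; simp [basisVec, hl]
  · simp

lemma coordGradPairing_eq_zero (i : Fin 3) {p : L2 E3} (hp : p ∈ Hdiv0) (u : H1) :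
    coordGradPairing i p u = 0 := by
  refine clm_eq_zero_of_testH1 _ (fun F hF => ?_) u
  have hψ := hF.coord i
  have h1 := mem_Hdiv0_iff_inner.1 hp _ hψ
  rw [inner_testL2] at h1
  rw [coordGradPairing_apply, ← h1]
  refine Finset.sum_congr rfl fun j _ => integral_congr_ae ?_
  filter_upwards [testL2_ae (hF.pdv j)] with x hx
  have : der (testH1 hF) j x = pdv j F x := hx
  rw [this, pdv_coord hF, gradTest_apply, mul_comm]

/-- The embedding of scalar functions as vector fields with values in a line. -/
noncomputable def lineField (i : Fin 3) : L2 ℝ →L[ℝ] L2 E3 :=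
  ((ContinuousLinearMap.id ℝ ℝ).smulRight (basisVec i)).compLpL 2 volume

lemma lineField_ae (i : Fin 3) (φ : L2 ℝ) :
    (lineField i φ : E3 → E3) =ᵐ[volume] fun x => φ x • basisVec i :=
  ContinuousLinearMap.coeFn_compLpL _ _

lemma isWeakPartial_lineField (i : Fin 3) {j : Fin 3} {φ χ : L2 ℝ} (h : IsWeakPartial j φ χ) :
    IsWeakPartial j (lineField i φ) (lineField i χ) := by
  refine (isWeakPartial_congr (lineField_ae i φ) (lineField_ae i χ)).2 fun ψ hψ => ?_
  simp only [← smul_assoc]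
  rw [integral_smul_const, integral_smul_const, h ψ hψ, neg_smul]

/-- Gradients of `H²` functions are orthogonal to divergence free fields: for `φ ∈ H²` the pairing
`∫ ∂_jφ p^j` is the value of a functional that vanishes on the dense test fields. -/
lemma inner_fld_gradH2 {k : H1} (hk : k ∈ gradH2) {p : L2 E3} (hp : p ∈ Hdiv0) :
    ⟪fld k, p⟫ = 0 := by
  obtain ⟨φ, hφ⟩ := hk
  -- density is available for vector fields, so `φ` is placed in the component `0` of one
  have hφ' : ∀ j, IsWeakPartial j φ
      ((EuclideanSpace.proj j : E3 →L[ℝ] ℝ).compLpL 2 volume (fld k)) :=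
    fun j => (isWeakPartial_congr (EventuallyEq.refl _ _) (coord_ae j (fld k))).2 (hφ j)
  have h := coordGradPairing_eq_zero 0 hp
    (mkH1 (lineField 0 φ) _ fun j => isWeakPartial_lineField 0 (hφ' j))
  rw [coordGradPairing_apply] at h
  rw [inner_L2, ← h]
  refine Finset.sum_congr rfl fun j _ => integral_congr_ae ?_
  filter_upwards [coord_ae j (fld k), lineField_ae 0
    ((EuclideanSpace.proj j : E3 →L[ℝ] ℝ).compLpL 2 volume (fld k))] with x h1 h2
  rw [der_mkH1, h2, h1]
  simp [basisVec, mul_comm]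

lemma inner_fld_K {k : H1} (hk : k ∈ K) {p : L2 E3} (hp : p ∈ Hdiv0) : ⟪fld k, p⟫ = 0 := by
  have hc : IsClosed {k : H1 | ⟪fld k, p⟫ = 0} :=
    isClosed_eq (fldL.continuous.inner continuous_const) continuous_const
  exact closure_minimal (fun k hk => inner_fld_gradH2 hk hp) hc hk

/-- The closed span in `H¹(Σ)` of the gradients of test functions. -/
noncomputable def testGradients : Submodule ℝ H1 :=
  (Submodule.span ℝ {a : H1 | ∃ (ψ : E3 → ℝ) (hψ : IsTest ψ),
    a = testH1 hψ.gradTest}).topologicalClosure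

lemma testGradients_le_K : testGradients ≤ K := by
  refine Submodule.topologicalClosure_minimal _ (Submodule.span_le.2 ?_)
    gradH2.isClosed_topologicalClosure
  rintro _ ⟨ψ, hψ, rfl⟩
  exact gradH2_le_K (testH1_gradTest_mem_gradH2 hψ)

lemma orthogonal_testGradients : testGradientsᗮ = H1div0 := by
  ext a
  rw [testGradients, Submodule.orthogonal_closure, mem_H1div0_iff_inner]
  constructor
  · intro h ψ hψ
    exact (Submodule.mem_orthogonal _ _).1 h _ (Submodule.subset_span ⟨ψ, hψ, rfl⟩)
  · intro h
    rw [Submodule.mem_orthogonal]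
    intro u hu
    induction hu using Submodule.span_induction with
    | mem u hu => obtain ⟨ψ, hψ, rfl⟩ := hu; exact h ψ hψ
    | zero => simp
    | add u v _ _ h1 h2 => rw [inner_add_left, h1, h2, add_zero]
    | smul c u _ h1 => rw [inner_smul_left, h1, mul_zero]

instance : CompleteSpace testGradients :=
  (Submodule.isClosed_topologicalClosure _).completeSpace_coe

/-- Test functions suffice to define `K`: the component of a gradient orthogonal to the gradients
of test functions is divergence free, so its `L²` norm vanishes. -/
lemma K_eq_testGradients : K = testGradients := by
  refine le_antisymm (fun k hk => ?_) testGradients_le_K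
  obtain ⟨g, hg, b, hb, rfl⟩ := testGradients.exists_add_mem_mem_orthogonal k
  rw [orthogonal_testGradients] at hb
  have h1 := inner_fld_K hk (mem_H1div0.1 hb)
  have h2 := inner_fld_K (testGradients_le_K hg) (mem_H1div0.1 hb)
  have h3 : fld (g + b) = fld g + fld b := rfl
  rw [h3, inner_add_left, h2, zero_add, inner_self_eq_zero] at h1
  have hb0 : b = 0 := fld_injective h1
  rwa [hb0, add_zero]

lemma orthogonal_K : Kᗮ = H1div0 := by
  rw [K_eq_testGradients, orthogonal_testGradients]

/-- The Helmholtz splitting `H¹(Σ) = H¹(div0, Σ) ⊕ K`. -/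
theorem isCompl_H1div0_K : IsCompl H1div0 K := by
  rw [← orthogonal_K]
  exact (Submodule.isCompl_orthogonal (K := K)).symm

/-- Fields of class `H¹` are dense in `L²`. -/
lemma eq_zero_of_inner_fld {p : L2 E3} (h : ∀ a : H1, ⟪fld a, p⟫ = 0) : p = 0 := by
  refine dense_testL2.eq_zero_of_inner_left (𝕜 := ℝ) ?_
  rintro _ ⟨F, hF, rfl⟩
  rw [real_inner_comm]
  exact h (testH1 hF)

end Helmholtz

/-! ### One-parameter groups of rotations -/

section Rotations

/-- The infinitesimal rotation `x ↦ ξ x` of `Σ`. -/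
noncomputable def infRot (ξ : so3) : E3 →L[ℝ] E3 :=
  Matrix.toEuclideanCLM (n := Fin 3) (𝕜 := ℝ) (ξ : Matrix (Fin 3) (Fin 3) ℝ)

lemma infRot_apply (ξ : so3) (x : E3) (i : Fin 3) :
    infRot ξ x i = ∑ k, (ξ : Matrix (Fin 3) (Fin 3) ℝ) i k * x k := rfl

lemma so3_skew (ξ : so3) (i k : Fin 3) :
    (ξ : Matrix (Fin 3) (Fin 3) ℝ) i k = - (ξ : Matrix (Fin 3) (Fin 3) ℝ) k i :=
  congrFun (congrFun ((LieAlgebra.Orthogonal.mem_so (Fin 3) ℝ _).1 ξ.2) k) i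

lemma so3_diag (ξ : so3) (i : Fin 3) : (ξ : Matrix (Fin 3) (Fin 3) ℝ) i i = 0 := by
  have := so3_skew ξ i i
  linarith

lemma toEuclideanCLM_exp (A : Matrix (Fin 3) (Fin 3) ℝ) :
    Matrix.toEuclideanCLM (n := Fin 3) (𝕜 := ℝ) (NormedSpace.exp A)
      = NormedSpace.exp (Matrix.toEuclideanCLM (n := Fin 3) (𝕜 := ℝ) A) := by
  let _ : NormedRing (Matrix (Fin 3) (Fin 3) ℝ) := Matrix.linftyOpNormedRing
  let _ : NormedAlgebra ℝ (Matrix (Fin 3) (Fin 3) ℝ) := Matrix.linftyOpNormedAlgebra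
  let _ : NormedAlgebra ℚ (Matrix (Fin 3) (Fin 3) ℝ) := Matrix.linftyOpNormedAlgebra
  refine NormedSpace.map_exp (Matrix.toEuclideanCLM (n := Fin 3) (𝕜 := ℝ)) ?_ A
  exact LinearMap.continuous_of_finiteDimensional
    (Matrix.toEuclideanCLM (n := Fin 3) (𝕜 := ℝ)).toAlgEquiv.toLinearMap

lemma rot_exp_apply (ξ : so3) (θ : ℝ) (x : E3) :
    rot (expSO3 (θ • ξ)) x = NormedSpace.exp (θ • infRot ξ) x := by
  have h : Matrix.toEuclideanCLM (n := Fin 3) (𝕜 := ℝ)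
      (NormedSpace.exp (θ • (ξ : Matrix (Fin 3) (Fin 3) ℝ))) = NormedSpace.exp (θ • infRot ξ) := by
    rw [toEuclideanCLM_exp, map_smul]; rfl
  rw [← h]; rfl

lemma rot_exp_symm_apply (ξ : so3) (θ : ℝ) (x : E3) :
    (rot (expSO3 (θ • ξ))).symm x = NormedSpace.exp (θ • (-infRot ξ)) x := by
  rw [LinearIsometryEquiv.symm_apply_eq, rot_exp_apply]
  have h : NormedSpace.exp (θ • infRot ξ) * NormedSpace.exp (θ • (-infRot ξ))
      = (1 : E3 →L[ℝ] E3) := by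
    let _ : NormedAlgebra ℚ (E3 →L[ℝ] E3) := NormedAlgebra.restrictScalars ℚ ℝ _
    have h := NormedSpace.exp_add_of_commute (𝔸 := E3 →L[ℝ] E3)
      (Commute.neg_right (Commute.refl (θ • infRot ξ)))
    rw [add_neg_cancel, NormedSpace.exp_zero] at h
    rw [smul_neg, h]
  exact (congrArg (fun A : E3 →L[ℝ] E3 => A x) h).symm

/-- The infinitesimal rotation `ξ F - (ξx · ∂) F` of a smooth vector field. -/
noncomputable def infRotField (ξ : so3) (F : E3 → E3) : E3 → E3 :=
  fun x => infRot ξ (F x) - fderiv ℝ F x (infRot ξ x)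

lemma IsTestField.infRotField {F : E3 → E3} (hF : IsTestField F) (ξ : so3) :
    IsTestField (infRotField ξ F) := by
  refine ⟨((infRot ξ).contDiff.comp hF.1).sub
    ((hF.1.fderiv_right (m := ∞) (by simp)).clm_apply (infRot ξ).contDiff), ?_⟩
  refine HasCompactSupport.sub (f := fun x => infRot ξ (F x))
    (f' := fun x => fderiv ℝ F x (infRot ξ x)) (hF.2.comp_left (map_zero _)) ?_
  exact (hF.2.fderiv (𝕜 := ℝ)).mono fun x hx h => hx (by simp [h])

/-- The rotated field `x ↦ R F(R⁻¹ x)`. -/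
noncomputable def rotateField (ρ : E3 ≃ₗᵢ[ℝ] E3) (F : E3 → E3) : E3 → E3 :=
  fun x => ρ (F (ρ.symm x))

lemma hasDerivAt_rotateField {F : E3 → E3} (hF : IsTestField F) (ξ : so3) (x : E3) (θ : ℝ) :
    HasDerivAt (fun θ : ℝ => rotateField (rot (expSO3 (θ • ξ))) F x)
      (rotateField (rot (expSO3 (θ • ξ))) (infRotField ξ F) x) θ := by
  simp only [rotateField, rot_exp_apply, rot_exp_symm_apply]
  have h1 := hasDerivAt_exp_smul_const (𝕂 := ℝ) (infRot ξ) θ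
  have h2 := (hasDerivAt_exp_smul_const' (𝕂 := ℝ) (-infRot ξ) θ).clm_apply (hasDerivAt_const θ x)
  have h3 := ((hF.1.differentiable (by simp)) _).hasFDerivAt.comp_hasDerivAt θ h2
  have h4 := h1.clm_apply h3
  refine h4.congr_deriv ?_
  simp [infRotField, sub_eq_add_neg]

lemma norm_rotateField (ρ : E3 ≃ₗᵢ[ℝ] E3) (F : E3 → E3) (x : E3) :
    ‖rotateField ρ F x‖ = ‖F (ρ.symm x)‖ := ρ.norm_map _

lemma expSO3_zero_rotateField (ξ : so3) (F : E3 → E3) (x : E3) :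
    rotateField (rot (expSO3 ((0 : ℝ) • ξ))) F x = F x := by
  rw [expSO3_zero, map_one]; rfl

lemma continuous_rotateField {F : E3 → E3} (hF : Continuous F) (ρ : E3 ≃ₗᵢ[ℝ] E3) :
    Continuous (rotateField ρ F) :=
  ρ.continuous.comp (hF.comp ρ.symm.continuous)

/-- The difference quotient of the rotated field, minus its limit. -/
noncomputable def quotientError (ξ : so3) (F : E3 → E3) (θ : ℝ) (x : E3) : E3 :=
  θ⁻¹ • (rotateField (rot (expSO3 (θ • ξ))) F x - F x) - infRotField ξ F x

lemma tendsto_quotientError {F : E3 → E3} (hF : IsTestField F) (ξ : so3) (x : E3) :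
    Tendsto (fun θ => quotientError ξ F θ x) (𝓝[≠] 0) (𝓝 0) := by
  have h := hasDerivAt_iff_tendsto_slope_zero.1 (hasDerivAt_rotateField hF ξ x 0)
  simp only [expSO3_zero_rotateField, zero_add] at h
  simpa [quotientError] using h.sub_const (infRotField ξ F x)

lemma exists_bound_quotientError {F : E3 → E3} (hF : IsTestField F) (ξ : so3) :
    ∃ C r : ℝ, ∀ θ ≠ (0 : ℝ), ∀ x,
      ‖quotientError ξ F θ x‖ ≤ (Metric.closedBall (0 : E3) r).indicator (fun _ => C) x := by
  obtain ⟨C, hC⟩ := (hF.infRotField ξ).2.exists_bound_of_continuous (hF.infRotField ξ).1.continuous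
  obtain ⟨r, hr⟩ := hF.2.isCompact.isBounded.subset_closedBall (0 : E3)
  refine ⟨2 * C, r, fun θ hθ x => ?_⟩
  by_cases hx : x ∈ Metric.closedBall (0 : E3) r
  · rw [Set.indicator_of_mem hx]
    have h1 := (convex_univ (𝕜 := ℝ) (E := ℝ)).norm_image_sub_le_of_norm_hasDerivWithin_le
      (fun t _ => (hasDerivAt_rotateField hF ξ x t).hasDerivWithinAt)
      (fun t _ => (norm_rotateField _ _ _).trans_le (hC _)) (Set.mem_univ 0) (Set.mem_univ θ)
    rw [expSO3_zero_rotateField, sub_zero] at h1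
    calc ‖quotientError ξ F θ x‖ ≤ ‖θ⁻¹ • (rotateField (rot (expSO3 (θ • ξ))) F x - F x)‖
          + ‖infRotField ξ F x‖ := norm_sub_le _ _
      _ ≤ ‖θ‖⁻¹ * (C * ‖θ‖) + C := by
          rw [norm_smul, norm_inv]
          gcongr
          exact hC x
      _ = 2 * C := by
          have : ‖θ‖ ≠ 0 := norm_ne_zero_iff.2 hθ
          field_simp; ring
  · rw [Set.indicator_of_notMem hx]
    -- rotations preserve the complement of the ball, where the field vanishes
    have hz : ∀ y : E3, ‖y‖ = ‖x‖ → y ∉ tsupport F := by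
      intro y hy h
      apply hx
      have := hr h
      rwa [mem_closedBall_zero_iff, hy, ← mem_closedBall_zero_iff] at this
    have h1 : F x = 0 := image_eq_zero_of_notMem_tsupport (hz x rfl)
    have h2 : F ((rot (expSO3 (θ • ξ))).symm x) = 0 :=
      image_eq_zero_of_notMem_tsupport (hz _ (LinearIsometryEquiv.norm_map _ _))
    have h3 : fderiv ℝ F x = 0 := fderiv_of_notMem_tsupport ℝ (hz x rfl)
    simp [quotientError, rotateField, infRotField, h1, h2, h3]

lemma norm_sq_L2 (f : L2 E3) : ‖f‖ ^ 2 = ∫ x, ‖f x‖ ^ 2 := by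
  rw [← real_inner_self_eq_norm_sq, L2.inner_def]
  simp only [real_inner_self_eq_norm_sq]

lemma push_testL2_ae {F : E3 → E3} (hF : IsTestField F) (ρ : E3 ≃ₗᵢ[ℝ] E3) :
    (push ρ (testL2 hF) : E3 → E3) =ᵐ[volume] rotateField ρ F := by
  filter_upwards [push_ae ρ (testL2 hF),
    ρ.symm.measurePreserving.quasiMeasurePreserving.ae (testL2_ae hF)] with x h1 h2
  rw [h1, h2]; rfl

/-- Test fields are differentiable vectors for the rotations in `L²`, by dominated convergence. -/
lemma hasDerivAt_push_testL2 {F : E3 → E3} (hF : IsTestField F) (ξ : so3) :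
    HasDerivAt (fun θ : ℝ => push (rot (expSO3 (θ • ξ))) (testL2 hF))
      (testL2 (hF.infRotField ξ)) 0 := by
  rw [hasDerivAt_iff_tendsto_slope_zero]
  have h0 : push (rot (expSO3 ((0 : ℝ) • ξ))) (testL2 hF) = testL2 hF := by
    refine Lp.ext ((push_testL2_ae hF _).trans (EventuallyEq.trans ?_ (testL2_ae hF).symm))
    exact Eventually.of_forall (expSO3_zero_rotateField ξ F)
  simp only [h0, zero_add]
  rw [tendsto_iff_norm_sub_tendsto_zero]
  have hsq : ∀ θ : ℝ, ‖θ⁻¹ • (push (rot (expSO3 (θ • ξ))) (testL2 hF) - testL2 hF)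
      - testL2 (hF.infRotField ξ)‖ ^ 2 = ∫ x, ‖quotientError ξ F θ x‖ ^ 2 := by
    intro θ
    rw [norm_sq_L2]
    refine integral_congr_ae ?_
    filter_upwards [Lp.coeFn_sub (θ⁻¹ • (push (rot (expSO3 (θ • ξ))) (testL2 hF) - testL2 hF))
        (testL2 (hF.infRotField ξ)),
      Lp.coeFn_smul θ⁻¹ (push (rot (expSO3 (θ • ξ))) (testL2 hF) - testL2 hF),
      Lp.coeFn_sub (push (rot (expSO3 (θ • ξ))) (testL2 hF)) (testL2 hF),
      push_testL2_ae hF (rot (expSO3 (θ • ξ))), testL2_ae hF,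
      testL2_ae (hF.infRotField ξ)] with x h1 h2 h3 h4 h5 h6
    rw [h1, Pi.sub_apply, h2, Pi.smul_apply, h3, Pi.sub_apply, h4, h5, h6]
    rfl
  obtain ⟨C, r, hCr⟩ := exists_bound_quotientError hF ξ
  have hlim : Tendsto (fun θ : ℝ => ∫ x, ‖quotientError ξ F θ x‖ ^ 2) (𝓝[≠] 0) (𝓝 0) := by
    have := tendsto_integral_filter_of_dominated_convergence (μ := (volume : Measure E3))
      (l := 𝓝[≠] (0 : ℝ)) (F := fun θ x => ‖quotientError ξ F θ x‖ ^ 2) (f := fun _ => (0 : ℝ))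
      ((Metric.closedBall (0 : E3) r).indicator fun _ => C ^ 2) ?_ ?_ ?_ ?_
    · simpa using this
    · refine Eventually.of_forall fun θ => Continuous.aestronglyMeasurable ?_
      have h1 := continuous_rotateField hF.1.continuous (rot (expSO3 (θ • ξ)))
      have h2 := hF.1.continuous
      have h3 := (hF.infRotField ξ).1.continuous
      unfold quotientError
      fun_prop
    · filter_upwards [self_mem_nhdsWithin] with θ hθ
      refine Eventually.of_forall fun x => ?_
      have h := hCr θ hθ x
      rw [Real.norm_eq_abs, abs_of_nonneg (by positivity)]
      by_cases hx : x ∈ Metric.closedBall (0 : E3) r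
      · rw [Set.indicator_of_mem hx] at h ⊢
        gcongr
      · rw [Set.indicator_of_notMem hx] at h ⊢
        rw [le_antisymm h (norm_nonneg _)]; simp
    · exact (integrableOn_const measure_closedBall_lt_top.ne).integrable_indicator
        measurableSet_closedBall
    · refine Eventually.of_forall fun x => ?_
      simpa using ((tendsto_quotientError hF ξ x).norm).pow 2
  simp only [← hsq] at hlim
  have := hlim.sqrt
  simpa using this

end Rotations

/-! ### The rotation actions on the function spaces -/

section Actions

lemma push_refl (p : L2 E3) : push (rot 1) p = p := by
  refine Lp.ext ?_
  filter_upwards [push_ae (rot 1) p] with x hx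
  rw [hx, map_one]; rfl

lemma push_mul (R S : SO3) (p : L2 E3) : push (rot (R * S)) p = push (rot R) (push (rot S) p) := by
  refine Lp.ext ?_
  filter_upwards [push_ae (rot (R * S)) p, push_ae (rot R) (push (rot S) p),
    (rot R).symm.measurePreserving.quasiMeasurePreserving.ae (push_ae (rot S) p)] with x h1 h2 h3
  rw [h1, h2, h3, map_mul]; rfl

lemma inner_push (ρ : E3 ≃ₗᵢ[ℝ] E3) (f g : L2 E3) : ⟪push ρ f, push ρ g⟫ = ⟪f, g⟫ := by
  rw [L2.inner_def, L2.inner_def, ← integral_rot ρ.symm fun x => ⟪f x, g x⟫]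
  refine integral_congr_ae ?_
  filter_upwards [push_ae ρ f, push_ae ρ g] with x h1 h2
  rw [h1, h2, ρ.inner_map_map]

lemma rot_symm_apply (R : SO3) (x : E3) : (rot R).symm x
    = Matrix.toEuclideanCLM (n := Fin 3) (𝕜 := ℝ) (R : Matrix (Fin 3) (Fin 3) ℝ).transpose x := by
  rw [LinearIsometryEquiv.symm_apply_eq]
  have h : Matrix.toEuclideanCLM (n := Fin 3) (𝕜 := ℝ) (R : Matrix (Fin 3) (Fin 3) ℝ)
      * Matrix.toEuclideanCLM (n := Fin 3) (𝕜 := ℝ) (R : Matrix (Fin 3) (Fin 3) ℝ).transpose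
      = 1 := by
    rw [← map_mul, (Matrix.mem_orthogonalGroup_iff (Fin 3) ℝ).1
      ((Matrix.mem_specialOrthogonalGroup_iff).1 R.2).1, map_one]
  exact (congrArg (fun A : E3 →L[ℝ] E3 => A x) h).symm

lemma continuous_toEuclideanCLM :
    Continuous (Matrix.toEuclideanCLM (n := Fin 3) (𝕜 := ℝ)) :=
  LinearMap.continuous_of_finiteDimensional
    (Matrix.toEuclideanCLM (n := Fin 3) (𝕜 := ℝ)).toAlgEquiv.toLinearMap

lemma continuous_rot_symm_uncurry : Continuous fun q : SO3 × E3 => (rot q.1).symm q.2 := by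
  simp only [rot_symm_apply]
  exact (continuous_toEuclideanCLM.comp
    (continuous_subtype_val.comp continuous_fst).matrix_transpose).clm_apply continuous_snd

lemma continuous_push (p : L2 E3) : Continuous fun R : SO3 => push (rot R) p := by
  have h1 : Continuous fun R : SO3 => (⟨(rot R).symm, (rot R).symm.continuous⟩ : C(E3, E3)) :=
    ContinuousMap.continuous_of_continuous_uncurry _ continuous_rot_symm_uncurry
  have h2 : Continuous fun R : SO3 =>
      Lp.compMeasurePreserving (rot R).symm (rot R).symm.measurePreserving p :=
    (continuous_const (y := p)).compMeasurePreservingLp h1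
      (fun R => (rot R).symm.measurePreserving) (by simp)
  have h3 : Continuous fun R : SO3 => (ContinuousLinearMap.id ℝ (E3 →L[ℝ] E3)).compLpL₂ 2
      (volume : Measure E3) (Matrix.toEuclideanCLM (n := Fin 3) (𝕜 := ℝ)
        (R : Matrix (Fin 3) (Fin 3) ℝ)) :=
    (ContinuousLinearMap.continuous _).comp
      (continuous_toEuclideanCLM.comp continuous_subtype_val)
  exact h3.clm_apply h2

lemma isDenselyGenerated_push : IsDenselyGenerated fun R : SO3 => push (rot R) where
  map_one := push_refl
  map_mul := push_mul
  continuous_orbit := continuous_push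
  dense_domain := dense_testL2.mono (by
    rintro _ ⟨F, hF, rfl⟩
    exact mem_genDomain_of_hasDerivAt _ (hasDerivAt_push_testL2 hF))

lemma testL2_mem_genDomain {F : E3 → E3} (hF : IsTestField F) :
    testL2 hF ∈ genDomain fun R : SO3 => push (rot R) :=
  mem_genDomain_of_hasDerivAt _ (hasDerivAt_push_testL2 hF)

lemma fundField_testL2 {F : E3 → E3} (hF : IsTestField F) (ξ : so3) :
    fundField (fun R : SO3 => push (rot R)) ξ (testL2 hF) = testL2 (hF.infRotField ξ) :=
  (hasDerivAt_push_testL2 hF ξ).deriv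

lemma fld_rotH1 (R : SO3) (a : H1) : fld (rotH1 R a) = push (rot R) (fld a) := rfl

lemma der_rotH1 (R : SO3) (a : H1) (j : Fin 3) :
    der (rotH1 R a) j = ∑ k, ((rot R).symm (basisVec j) k) • push (rot R) (der a k) :=
  pushJet_some _ _ _

lemma sum_symm_basisVec (ρ : E3 ≃ₗᵢ[ℝ] E3) (k l : Fin 3) :
    ∑ j, ρ.symm (basisVec j) k * ρ.symm (basisVec j) l = if k = l then 1 else 0 := by
  have h : ∀ j k, ρ.symm (basisVec j) k = ρ (basisVec k) j := by
    intro j k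
    have h1 : ρ.symm (basisVec j) k = ⟪ρ.symm (basisVec j), basisVec k⟫ := by
      simp [basisVec, EuclideanSpace.inner_single_right]
    have h2 : ρ (basisVec k) j = ⟪basisVec j, ρ (basisVec k)⟫ := by
      simp [basisVec, EuclideanSpace.inner_single_left]
    rw [h1, h2, ← ρ.inner_map_map, ρ.apply_symm_apply]
  have h3 : ⟪ρ (basisVec k), ρ (basisVec l)⟫ = if k = l then 1 else 0 := by
    rw [ρ.inner_map_map]
    simp [basisVec, EuclideanSpace.inner_single_left]
  rw [← h3, PiLp.inner_apply]
  refine Finset.sum_congr rfl fun j _ => ?_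
  rw [h, h]; simp [mul_comm]

lemma sum_inner_orthogonal {V : Type*} [NormedAddCommGroup V] [InnerProductSpace ℝ V]
    {c : Fin 3 → Fin 3 → ℝ} (hc : ∀ k l, ∑ j, c j k * c j l = if k = l then 1 else 0)
    (f g : Fin 3 → V) :
    ∑ j, ⟪∑ k, c j k • f k, ∑ l, c j l • g l⟫ = ∑ k, ⟪f k, g k⟫ := by
  have h1 : ∀ j, ⟪∑ k, c j k • f k, ∑ l, c j l • g l⟫
      = ∑ k, ∑ l, c j k * c j l * ⟪f k, g l⟫ := by
    intro j
    rw [sum_inner]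
    refine Finset.sum_congr rfl fun k _ => ?_
    rw [inner_sum]
    refine Finset.sum_congr rfl fun l _ => ?_
    rw [real_inner_smul_left, real_inner_smul_right, mul_assoc]
  simp only [h1]
  rw [Finset.sum_comm]
  refine Finset.sum_congr rfl fun k _ => ?_
  rw [Finset.sum_comm]
  simp only [← Finset.sum_mul, hc]
  simp

lemma inner_rotH1 (R : SO3) (a b : H1) : ⟪rotH1 R a, rotH1 R b⟫ = ⟪a, b⟫ := by
  rw [inner_H1, inner_H1, fld_rotH1, fld_rotH1, inner_push]
  simp only [der_rotH1]
  rw [sum_inner_orthogonal (c := fun j k => (rot R).symm (basisVec j) k)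
    (sum_symm_basisVec (rot R))]
  simp only [inner_push]

lemma continuous_of_jet {X : Type*} [TopologicalSpace X] {u : X → H1}
    (h0 : Continuous fun x => fld (u x)) (h1 : ∀ j, Continuous fun x => der (u x) j) :
    Continuous u := by
  refine Continuous.subtype_mk (p := fun v => v ∈ H1) (f := fun x => (u x : Jet)) ?_ _
  refine (PiLp.continuousLinearEquiv 2 ℝ
    (fun _ : Option (Fin 3) => L2 E3)).symm.continuous.comp
      (g := (PiLp.continuousLinearEquiv 2 ℝ (fun _ : Option (Fin 3) => L2 E3)).symm)
      (f := fun x o => (u x : Jet) o) (continuous_pi fun o => ?_)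
  cases o with
  | none => exact h0
  | some j => exact h1 j

lemma rotH1_one (a : H1) : rotH1 1 a = a :=
  fld_injective (push_refl (fld a))

lemma rotH1_mul (R S : SO3) (a : H1) : rotH1 (R * S) a = rotH1 R (rotH1 S a) :=
  fld_injective (push_mul R S (fld a))

lemma continuous_rot_symm (x : E3) : Continuous fun R : SO3 => (rot R).symm x := by
  simp only [rot_symm_apply]
  exact (continuous_toEuclideanCLM.comp continuous_subtype_val.matrix_transpose).clm_apply
    continuous_const

lemma continuous_rotH1 (a : H1) : Continuous fun R : SO3 => rotH1 R a := by
  refine continuous_of_jet (continuous_push (fld a)) fun j => ?_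
  simp only [der_rotH1]
  refine continuous_finsetSum _ fun k _ => ?_
  exact ((EuclideanSpace.proj k : E3 →L[ℝ] ℝ).continuous.comp
    (continuous_rot_symm (basisVec j))).smul (continuous_push _)

lemma differentiableAt_rot_symm (ξ : so3) (x : E3) :
    DifferentiableAt ℝ (fun θ : ℝ => (rot (expSO3 (θ • ξ))).symm x) 0 := by
  simp only [rot_exp_symm_apply]
  exact ((hasDerivAt_exp_smul_const (𝕂 := ℝ) (-infRot ξ) 0).clm_apply
    (hasDerivAt_const 0 x)).differentiableAt

lemma differentiableAt_of_jet {u : ℝ → H1} {t : ℝ}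
    (h0 : DifferentiableAt ℝ (fun θ => fld (u θ)) t)
    (h1 : ∀ j, DifferentiableAt ℝ (fun θ => der (u θ) j) t) : DifferentiableAt ℝ u t := by
  have hpi : DifferentiableAt ℝ (fun θ (o : Option (Fin 3)) => (u θ : Jet) o) t := by
    refine differentiableAt_pi.2 fun o => ?_
    cases o with
    | none => exact h0
    | some j => exact h1 j
  have hJ : DifferentiableAt ℝ (fun θ => (u θ : Jet)) t :=
    (PiLp.continuousLinearEquiv 2 ℝ
      (fun _ : Option (Fin 3) => L2 E3)).symm.toContinuousLinearMap.differentiableAt.comp t hpi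
  -- composing with the projection onto `H1` shows that the derivative in `Jet` lies in `H1`
  have hP := H1.orthogonalProjectionOnto.differentiableAt.comp t hJ
  have e : ∀ b : H1, H1.orthogonalProjectionOnto (b : Jet) = b := fun b =>
    Submodule.orthogonalProjectionOnto_mem_subspace_eq_self b
  simpa only [Function.comp_def, e] using hP

lemma testH1_mem_genDomain {F : E3 → E3} (hF : IsTestField F) : testH1 hF ∈ genDomain rotH1 := by
  intro ξ
  refine differentiableAt_of_jet (testL2_mem_genDomain hF ξ) fun j => ?_
  simp only [der_rotH1]
  refine DifferentiableAt.fun_sum fun k _ => ?_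
  exact ((EuclideanSpace.proj k : E3 →L[ℝ] ℝ).differentiableAt.comp (0 : ℝ)
    (differentiableAt_rot_symm ξ (basisVec j))).smul (testL2_mem_genDomain (hF.pdv k) ξ)

lemma isDenselyGenerated_rotH1 : IsDenselyGenerated rotH1 where
  map_one := rotH1_one
  map_mul := rotH1_mul
  continuous_orbit := continuous_rotH1
  dense_domain := dense_span_testH1.mono (by
    intro a ha
    induction ha using Submodule.span_induction with
    | mem a ha => obtain ⟨F, hF, rfl⟩ := ha; exact testH1_mem_genDomain hF
    | zero => intro ξ; simp
    | add a b _ _ h1 h2 => exact add_mem_genDomain h1 h2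
    | smul c a _ h =>
      exact map_mem_genDomain (c • ContinuousLinearMap.id ℝ H1) (fun R m => by simp) h)

/-! ### The invariant subspaces -/

/-- The orthogonal projection onto a subspace that, like its complement, is invariant under a
bounded operator commutes with this operator. -/
lemma orthogonalProjectionOnto_comm {V : Type*} [NormedAddCommGroup V] [InnerProductSpace ℝ V]
    {S : Submodule ℝ V} [S.HasOrthogonalProjection] {T : V → V} (hT : ∀ a b, T (a + b) = T a + T b)
    (h1 : ∀ a ∈ S, T a ∈ S) (h2 : ∀ a ∈ Sᗮ, T a ∈ Sᗮ) (a : V) :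
    (S.orthogonalProjectionOnto (T a) : V) = T (S.orthogonalProjectionOnto a : V) := by
  obtain ⟨y, hy, z, hz, rfl⟩ := S.exists_add_mem_mem_orthogonal a
  have e : ∀ u v : V, u ∈ S → v ∈ Sᗮ → (S.orthogonalProjectionOnto (u + v) : V) = u := by
    intro u v hu hv
    exact Submodule.eq_starProjection_of_mem_orthogonal' hu hv rfl
  rw [hT, e _ _ (h1 y hy) (h2 z hz), e _ _ hy hz]

lemma isClosed_Hdiv0 : IsClosed (Hdiv0 : Set (L2 E3)) := by
  have : (Hdiv0 : Set (L2 E3)) = ⋂ (ψ : E3 → ℝ) (hψ : IsTest ψ),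
      {p : L2 E3 | ⟪testL2 hψ.gradTest, p⟫ = 0} := by
    ext p
    simp only [Set.mem_iInter, Set.mem_ofPred_eq]
    exact mem_Hdiv0_iff_inner
  rw [this]
  exact isClosed_iInter fun ψ => isClosed_iInter fun hψ =>
    isClosed_eq (continuous_const.inner continuous_id) continuous_const

instance : CompleteSpace Hdiv0 := isClosed_Hdiv0.completeSpace_coe

lemma push_mem_orthogonal_Hdiv0 (R : SO3) {q : L2 E3} (hq : q ∈ Hdiv0ᗮ) :
    push (rot R) q ∈ Hdiv0ᗮ := by
  rw [Submodule.mem_orthogonal] at hq ⊢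
  intro p hp
  have e : p = push (rot R) (push (rot R⁻¹) p) := by
    rw [← push_mul, mul_inv_cancel, push_refl]
  rw [e, inner_push]
  exact hq _ (push_mem_Hdiv0 (rot R⁻¹) hp)

lemma isDenselyGenerated_rotHdiv0 : IsDenselyGenerated rotHdiv0 :=
  isDenselyGenerated_push.map Hdiv0.orthogonalProjectionOnto
    (fun R p => Subtype.ext (orthogonalProjectionOnto_comm (fun a b => map_add _ a b)
      (fun _ hp => push_mem_Hdiv0 (rot R) hp) (fun _ hq => push_mem_orthogonal_Hdiv0 R hq) p))
    (fun p => ⟨p, Submodule.orthogonalProjectionOnto_mem_subspace_eq_self p⟩)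

lemma rotH1_mem_H1div0_of_mem (R : SO3) {a : H1} (ha : a ∈ H1div0) : rotH1 R a ∈ H1div0 :=
  rotH1_mem_H1div0 R ⟨a, ha⟩

lemma rotH1_mem_K_of_mem (R : SO3) {a : H1} (ha : a ∈ K) : rotH1 R a ∈ K :=
  rotH1_mem_K R ⟨a, ha⟩

lemma orthogonal_H1div0 : H1div0ᗮ = K := by
  rw [← orthogonal_K, Submodule.orthogonal_orthogonal]

instance : H1div0.HasOrthogonalProjection := by
  rw [← orthogonal_K]; infer_instance

lemma isDenselyGenerated_rotH1div0 : IsDenselyGenerated rotH1div0 :=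
  isDenselyGenerated_rotH1.map H1div0.orthogonalProjectionOnto
    (fun R p => Subtype.ext (orthogonalProjectionOnto_comm (fun a b => map_add _ a b)
      (fun _ ha => rotH1_mem_H1div0_of_mem R ha)
      (fun _ ha => orthogonal_H1div0 ▸ rotH1_mem_K_of_mem R (orthogonal_H1div0 ▸ ha)) p))
    (fun p => ⟨p, Submodule.orthogonalProjectionOnto_mem_subspace_eq_self p⟩)

lemma isDenselyGenerated_rotK : IsDenselyGenerated rotK :=
  isDenselyGenerated_rotH1.map K.orthogonalProjectionOnto
    (fun R p => Subtype.ext (orthogonalProjectionOnto_comm (fun a b => map_add _ a b)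
      (fun _ ha => rotH1_mem_K_of_mem R ha)
      (fun _ ha => orthogonal_K ▸ rotH1_mem_H1div0_of_mem R (orthogonal_K ▸ ha)) p))
    (fun p => ⟨p, Submodule.orthogonalProjectionOnto_mem_subspace_eq_self p⟩)

lemma inner_rotK (R : SO3) (k l : K) : ⟪rotK R k, rotK R l⟫ = ⟪k, l⟫ :=
  inner_rotH1 R k l

lemma rotKdual_apply (R : SO3) (μ : K →L[ℝ] ℝ) (k : K) : rotKdual R μ k = μ (rotK R⁻¹ k) := rfl

/-- The dual action is the action on `K`, transported by the Riesz isomorphism. -/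
lemma isDenselyGenerated_rotKdual : IsDenselyGenerated rotKdual := by
  refine isDenselyGenerated_rotK.map
    ((InnerProductSpace.toDual ℝ K).toContinuousLinearEquiv.toContinuousLinearMap) ?_ ?_
  · intro R k
    ext l
    change ⟪rotK R k, l⟫ = ⟪k, rotK R⁻¹ l⟫
    have e : l = rotK R (rotK R⁻¹ l) := by
      rw [← isDenselyGenerated_rotK.map_mul, mul_inv_cancel, isDenselyGenerated_rotK.map_one]
    conv_lhs => rw [e]
    rw [inner_rotK]
  · exact (InnerProductSpace.toDual ℝ K).surjective

lemma rotKdual_pairing (R : SO3) (μ : K →L[ℝ] ℝ) (k : K) : rotKdual R μ (rotK R k) = μ k := by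
  rw [rotKdual_apply, ← isDenselyGenerated_rotK.map_mul, inv_mul_cancel,
    isDenselyGenerated_rotK.map_one]

end Actions

/-! ### The generators on `H¹(Σ)` as differential operators -/

section Generators

/-- The infinitesimal rotation `ξ a - (ξx · ∂) a` of a field of class `H¹`. -/
noncomputable def infRotH1 (ξ : so3) (a : H1) (x : E3) : E3 :=
  infRot ξ (fld a x) - ∑ k, infRot ξ x k • der a k x

lemma IsTest.infRot_mul {ψ : E3 → ℝ} (hψ : IsTest ψ) (ξ : so3) (k : Fin 3) :
    IsTest (fun x => infRot ξ x k * ψ x) :=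
  ⟨((EuclideanSpace.proj k : E3 →L[ℝ] ℝ).contDiff.comp (infRot ξ).contDiff).mul hψ.1,
    hψ.2.mul_left⟩

/-- The field `ξ x` is divergence free, even componentwise: `∂_k (ξx)_k = 0`. -/
lemma pd_infRot_mul {ψ : E3 → ℝ} (hψ : IsTest ψ) (ξ : so3) (k : Fin 3) (x : E3) :
    pd k (fun x => infRot ξ x k * ψ x) x = infRot ξ x k * pd k ψ x := by
  have h1 : HasFDerivAt (fun x => infRot ξ x k)
      ((EuclideanSpace.proj k : E3 →L[ℝ] ℝ).comp (infRot ξ)) x :=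
    ((EuclideanSpace.proj k : E3 →L[ℝ] ℝ).comp (infRot ξ)).hasFDerivAt
  have h2 := h1.mul ((hψ.1.differentiable (by simp)) x).hasFDerivAt
  have h3 : infRot ξ (basisVec k) k = 0 := by
    rw [infRot_apply]; simp [basisVec, so3_diag]
  have h4 : fderiv ℝ (fun x => infRot ξ x k * ψ x) x = _ := h2.fderiv
  rw [pd, h4]
  simp [h3, pd]

lemma infRotField_smul_basisVec {ψ : E3 → ℝ} (hψ : IsTest ψ) (ξ : so3) (i l : Fin 3) (x : E3) :
    infRotField ξ (fun x => ψ x • basisVec i) x l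
      = (ξ : Matrix (Fin 3) (Fin 3) ℝ) l i * ψ x
        - if l = i then ∑ k, infRot ξ x k * pd k ψ x else 0 := by
  have h := ((hψ.1.differentiable (by simp)) x).hasFDerivAt.smul_const (basisVec i)
  have h1 : fderiv ℝ (fun x => ψ x • basisVec i) x (infRot ξ x)
      = (∑ k, infRot ξ x k * pd k ψ x) • basisVec i := by
    rw [h.fderiv]
    simp only [ContinuousLinearMap.smulRight_apply, fderiv_eq_sum_pd]
    congr 1
    exact Finset.sum_congr rfl fun k _ => mul_comm _ _
  rw [infRotField, h1, PiLp.sub_apply, infRot_apply]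
  congr 1
  · simp [basisVec]
  · by_cases hl : l = i <;> simp [basisVec, hl]

lemma infRotH1_apply (ξ : so3) (a : H1) (x : E3) (i : Fin 3) :
    infRotH1 ξ a x i = ∑ k, (ξ : Matrix (Fin 3) (Fin 3) ℝ) i k * fld a x k
      - ∑ k, infRot ξ x k * der a k x i := by
  rw [infRotH1, PiLp.sub_apply, infRot_apply]
  simp [Fin.sum_univ_three]

/-- The weak form of the formula for the generators on `H¹(Σ)`, by invariance of the `L²` product
and integration by parts. -/
lemma integral_mul_fld_fundField {a : H1} (ha : a ∈ genDomain rotH1) (ξ : so3) {ψ : E3 → ℝ}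
    (hψ : IsTest ψ) (i : Fin 3) :
    ∫ x, ψ x * fld (fundField rotH1 ξ a) x i = ∫ x, ψ x * infRotH1 ξ a x i := by
  have hF := IsTestField.smul_const hψ (basisVec i)
  have hpair := pairing_fundField push_refl push_refl (innerSL ℝ : L2 E3 →L[ℝ] L2 E3 →L[ℝ] ℝ)
    (fun R v w => inner_push (rot R) v w) (testL2_mem_genDomain hF)
    (map_mem_genDomain (S := fun R : SO3 => push (rot R)) fldL (fun _ _ => rfl) ha) ξ
  rw [fundField_map (S := fun R : SO3 => push (rot R)) fldL (fun _ _ => rfl) ha,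
    fundField_testL2 hF] at hpair
  change ⟪testL2 (hF.infRotField ξ), fld a⟫ + ⟪testL2 hF, fld (fundField rotH1 ξ a)⟫ = 0 at hpair
  rw [inner_testL2_smul_basisVec i hF rfl, inner_testL2] at hpair
  simp only [infRotField_smul_basisVec hψ] at hpair
  have i1 : ∀ l, Integrable fun x => (ξ : Matrix (Fin 3) (Fin 3) ℝ) l i * ψ x * fld a x l := by
    intro l
    simp only [mul_assoc]
    exact (hψ.integrable_mul_coord (fld a) l).const_mul _
  have i2 : ∀ k, Integrable fun x => infRot ξ x k * pd k ψ x * fld a x i := fun k =>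
    ((hψ.pd k).infRot_mul ξ k).integrable_mul_coord (fld a) i
  have i3 : Integrable fun x => (∑ k, infRot ξ x k * pd k ψ x) * fld a x i := by
    simp only [Finset.sum_mul]
    exact integrable_finsetSum _ fun k _ => i2 k
  have i4 : ∀ k, Integrable fun x => infRot ξ x k * ψ x * der a k x i := fun k =>
    (hψ.infRot_mul ξ k).integrable_mul_coord (der a k) i
  have i5 : Integrable fun x => - ∑ l, (ξ : Matrix (Fin 3) (Fin 3) ℝ) l i * ψ x * fld a x l :=
    (integrable_finsetSum _ fun l _ => i1 l).neg
  -- the terms without derivatives of `ψ`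
  have e1 : ∑ l, ∫ x, ((ξ : Matrix (Fin 3) (Fin 3) ℝ) l i * ψ x
        - if l = i then ∑ k, infRot ξ x k * pd k ψ x else 0) * fld a x l
      = (∑ l, ∫ x, (ξ : Matrix (Fin 3) (Fin 3) ℝ) l i * ψ x * fld a x l)
        - ∫ x, (∑ k, infRot ξ x k * pd k ψ x) * fld a x i := by
    have : ∀ l, ∫ x, ((ξ : Matrix (Fin 3) (Fin 3) ℝ) l i * ψ x
        - if l = i then ∑ k, infRot ξ x k * pd k ψ x else 0) * fld a x l
        = (∫ x, (ξ : Matrix (Fin 3) (Fin 3) ℝ) l i * ψ x * fld a x l)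
          - if l = i then ∫ x, (∑ k, infRot ξ x k * pd k ψ x) * fld a x i else 0 := by
      intro l
      by_cases hl : l = i
      · subst hl
        simp only [if_true, sub_mul]
        exact integral_sub (i1 l) i3
      · simp only [hl, if_false, sub_zero]
    rw [Finset.sum_congr rfl fun l _ => this l, Finset.sum_sub_distrib]
    simp
  -- the terms with derivatives of `ψ`
  have e2 : ∫ x, (∑ k, infRot ξ x k * pd k ψ x) * fld a x i
      = - ∑ k, ∫ x, infRot ξ x k * ψ x * der a k x i := by
    simp only [Finset.sum_mul]
    rw [integral_finsetSum _ fun k _ => i2 k, ← Finset.sum_neg_distrib]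
    refine Finset.sum_congr rfl fun k _ => ?_
    rw [← isWeakPartial_coord (isWeakPartial_fld a k) (hψ.infRot_mul ξ k)]
    simp only [pd_infRot_mul hψ]
  have e3 : ∫ x, ψ x * infRotH1 ξ a x i
      = - (∑ l, ∫ x, (ξ : Matrix (Fin 3) (Fin 3) ℝ) l i * ψ x * fld a x l)
        - ∑ k, ∫ x, infRot ξ x k * ψ x * der a k x i := by
    rw [← integral_finsetSum _ fun l _ => i1 l, ← integral_finsetSum _ fun k _ => i4 k,
      ← integral_neg, ← integral_sub i5
        (integrable_finsetSum _ fun k _ => i4 k)]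
    refine integral_congr_ae (Eventually.of_forall fun x => ?_)
    simp only [infRotH1_apply, mul_sub, Finset.mul_sum, ← Finset.sum_neg_distrib]
    congr 1
    · refine Finset.sum_congr rfl fun l _ => ?_
      rw [so3_skew ξ i l]; ring
    · exact Finset.sum_congr rfl fun k _ => by ring
  rw [e1, e2] at hpair
  rw [e3]
  linarith

lemma locallyIntegrable_infRotH1 (ξ : so3) (a : H1) (i : Fin 3) :
    LocallyIntegrable (fun x => infRotH1 ξ a x i) := by
  have hl : ∀ (f : L2 E3) (j : Fin 3), LocallyIntegrable fun x => f x j := fun f j =>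
    (coord_memLp f j).locallyIntegrable (by norm_num)
  rw [locallyIntegrable_iff]
  intro S hS
  simp only [infRotH1_apply]
  refine Integrable.sub (integrable_finsetSum _ fun k _ => ?_)
    (integrable_finsetSum _ fun k _ => ?_)
  · exact ((hl (fld a) k).integrableOn_isCompact hS).const_mul _
  · exact ((hl (der a k) i).integrableOn_isCompact hS).continuousOn_mul
      (Continuous.continuousOn (by fun_prop)) hS

/-- On its domain, the generator of a rotation of `H¹(Σ)` is the first-order differential operator
`ξ a - (ξx · ∂) a`; in particular the latter is of class `H¹`. -/
theorem fld_fundField_rotH1 {a : H1} (ha : a ∈ genDomain rotH1) (ξ : so3) :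
    (fld (fundField rotH1 ξ a) : E3 → E3) =ᵐ[volume] infRotH1 ξ a := by
  have h : ∀ i, ∀ᵐ x, fld (fundField rotH1 ξ a) x i = infRotH1 ξ a x i := fun i =>
    ae_eq_of_integral_contDiff_smul_eq ((coord_memLp _ i).locallyIntegrable (by norm_num))
      (locallyIntegrable_infRotH1 ξ a i) fun ψ hψ hψc =>
        integral_mul_fld_fundField ha ξ ⟨hψ, hψc⟩ i
  filter_upwards [h 0, h 1, h 2] with x h0 h1 h2
  ext i
  fin_cases i
  exacts [h0, h1, h2]

lemma rotField_eq_infRotH1 (j : Fin 3) (a : H1) (x : E3) :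
    rotField j a x = infRotH1 (xi j) a x := by
  ext i
  rw [infRotH1_apply]
  simp only [infRot_apply, Fin.sum_univ_three]
  fin_cases j <;> fin_cases i <;> simp [rotField, orb, xi] <;> ring

lemma entry_apply (k l : Fin 3) (ξ : so3) :
    entry k l ξ = (ξ : Matrix (Fin 3) (Fin 3) ℝ) k l := rfl

lemma xiDual_xi (i j : Fin 3) : xiDual i (xi j) = if i = j then 1 else 0 := by
  fin_cases i <;> fin_cases j <;> simp [xiDual, entry_apply, xi]

lemma eq_sum_xiDual (ξ : so3) (k l : Fin 3) : (ξ : Matrix (Fin 3) (Fin 3) ℝ) k l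
    = ∑ j, xiDual j ξ * (xi j : Matrix (Fin 3) (Fin 3) ℝ) k l := by
  have h0 := so3_diag ξ
  have h1 := so3_skew ξ 0 1
  have h2 := so3_skew ξ 1 2
  have h3 := so3_skew ξ 2 0
  fin_cases k <;> fin_cases l <;>
    simp [xiDual, entry_apply, xi, Fin.sum_univ_three, h0, h1, h2, h3]

lemma infRotH1_eq_sum (ξ : so3) (a : H1) (x : E3) (i : Fin 3) :
    infRotH1 ξ a x i = ∑ j, xiDual j ξ * rotField j a x i := by
  simp only [rotField_eq_infRotH1, infRotH1_apply, infRot_apply]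
  simp only [eq_sum_xiDual ξ, Fin.sum_univ_three]
  ring

lemma fld_fundField_xi {a : H1} (ha : a ∈ genDomain rotH1) (j : Fin 3) :
    (fld (fundField rotH1 (xi j) a) : E3 → E3) =ᵐ[volume] rotField j a :=
  (fld_fundField_rotH1 ha (xi j)).trans
    (Eventually.of_forall fun x => (rotField_eq_infRotH1 j a x).symm)

lemma fundField_rotH1_eq_sum {a : H1} (ha : a ∈ genDomain rotH1) (ξ : so3) :
    fundField rotH1 ξ a = ∑ j, xiDual j ξ • fundField rotH1 (xi j) a := by
  apply fld_injective
  have e : fld (∑ j, xiDual j ξ • fundField rotH1 (xi j) a)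
      = ∑ j, xiDual j ξ • fld (fundField rotH1 (xi j) a) := by
    simp only [← fldL_apply, map_sum, map_smul]
  rw [e]
  refine Lp.ext ?_
  filter_upwards [fld_fundField_rotH1 ha ξ, sum_smul_ae (fun j => xiDual j ξ)
    (fun j => fld (fundField rotH1 (xi j) a)), fld_fundField_xi ha 0, fld_fundField_xi ha 1,
    fld_fundField_xi ha 2] with x h1 h2 h3 h4 h5
  rw [h1, h2]
  ext i
  rw [infRotH1_eq_sum]
  simp [Fin.sum_univ_three, h3, h4, h5]

end Generators

/-! ### The momentum maps -/

section Momentum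

lemma integral_sum_coord_mul (f g : L2 E3) : ∫ x, ∑ k, f x k * g x k = ⟪f, g⟫ := by
  rw [inner_L2, integral_finsetSum _ fun k _ => integrable_coord_mul_coord f g k k]

lemma integrable_sum_coord_mul (f g : L2 E3) : Integrable fun x => ∑ k, f x k * g x k :=
  integrable_finsetSum _ fun k _ => integrable_coord_mul_coord f g k k

lemma integral_symplectic (a b p q : L2 E3) :
    ∫ x, ∑ k, (a x k * q x k - p x k * b x k) = ⟪a, q⟫ - ⟪b, p⟫ := by
  rw [← integral_sum_coord_mul, ← integral_sum_coord_mul,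
    ← integral_sub (integrable_sum_coord_mul a q) (integrable_sum_coord_mul b p)]
  refine integral_congr_ae (Eventually.of_forall fun x => ?_)
  simp only [Finset.sum_sub_distrib, mul_comm]

lemma omegaM_eq (X Y : Minf) :
    omegaM X Y = ⟪fld X.1, (Y.2 : L2 E3)⟫ - ⟪fld Y.1, (X.2 : L2 E3)⟫ :=
  integral_symplectic _ _ _ _

lemma omegaP_eq (ε : ℝ) (X Y : P) : omegaP ε X Y
    = ⟪fld (pot X), mom Y⟫ - ⟪fld (pot Y), mom X⟫ + ε * (mu Y (dphi X) - mu X (dphi Y)) := by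
  rw [omegaP, integral_symplectic]

/-- The combination `B + c C` of two bounded bilinear forms. -/
noncomputable def combinePairings {V : Type} [NormedAddCommGroup V] [NormedSpace ℝ V] (c : ℝ)
    (B C : V →L[ℝ] V →L[ℝ] ℝ) : V →L[ℝ] V →L[ℝ] ℝ := B + c • C

lemma combinePairings_apply {V : Type} [NormedAddCommGroup V] [NormedSpace ℝ V] (c : ℝ)
    (B C : V →L[ℝ] V →L[ℝ] ℝ) (v w : V) : combinePairings c B C v w = B v w + c * C v w := rfl

/-- The bilinear form `∫ X_a · Y_p` on `M_∞`, whose antisymmetrization is the two-form. -/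
noncomputable def pairingM : Minf →L[ℝ] Minf →L[ℝ] ℝ :=
  (innerSL ℝ : L2 E3 →L[ℝ] L2 E3 →L[ℝ] ℝ).bilinearComp
    (fldL.comp (ContinuousLinearMap.fst ℝ H1 Hdiv0))
    (Hdiv0.subtypeL.comp (ContinuousLinearMap.snd ℝ H1 Hdiv0))

lemma pairingM_apply (X Y : Minf) : pairingM X Y = ⟪fld X.1, (Y.2 : L2 E3)⟫ := rfl

/-- The component `ã` of a point of `P`, as a bounded operator. -/
noncomputable def potL : P →L[ℝ] H1 :=
  H1div0.subtypeL.comp (ContinuousLinearMap.fst ℝ H1div0 (K × Hdiv0 × (K →L[ℝ] ℝ)))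

/-- The component `∂φ` of a point of `P`, as a bounded operator. -/
noncomputable def dphiL : P →L[ℝ] K :=
  (ContinuousLinearMap.fst ℝ K (Hdiv0 × (K →L[ℝ] ℝ))).comp
    (ContinuousLinearMap.snd ℝ H1div0 (K × Hdiv0 × (K →L[ℝ] ℝ)))

/-- The component `p` of a point of `P`, as a bounded operator. -/
noncomputable def momL : P →L[ℝ] Hdiv0 :=
  (ContinuousLinearMap.fst ℝ Hdiv0 (K →L[ℝ] ℝ)).comp
    ((ContinuousLinearMap.snd ℝ K (Hdiv0 × (K →L[ℝ] ℝ))).comp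
      (ContinuousLinearMap.snd ℝ H1div0 (K × Hdiv0 × (K →L[ℝ] ℝ))))

/-- The component `μ` of a point of `P`, as a bounded operator. -/
noncomputable def muL : P →L[ℝ] (K →L[ℝ] ℝ) :=
  (ContinuousLinearMap.snd ℝ Hdiv0 (K →L[ℝ] ℝ)).comp
    ((ContinuousLinearMap.snd ℝ K (Hdiv0 × (K →L[ℝ] ℝ))).comp
      (ContinuousLinearMap.snd ℝ H1div0 (K × Hdiv0 × (K →L[ℝ] ℝ))))

/-- The bilinear form `∫ X_ã · Y_p` on `P`. -/
noncomputable def pairingField : P →L[ℝ] P →L[ℝ] ℝ :=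
  (innerSL ℝ : L2 E3 →L[ℝ] L2 E3 →L[ℝ] ℝ).bilinearComp (fldL.comp potL) (Hdiv0.subtypeL.comp momL)

/-- The bilinear form `⟨Y_μ, X_∂φ⟩` on `P`. -/
noncomputable def pairingDual : P →L[ℝ] P →L[ℝ] ℝ :=
  (ContinuousLinearMap.id ℝ (K →L[ℝ] ℝ)).flip.bilinearComp dphiL muL

/-- The bilinear form `∫ X_ã · Y_p + ε ⟨Y_μ, X_∂φ⟩` on `P`, whose antisymmetrization is the
symplectic form. -/
noncomputable def pairingP (ε : ℝ) : P →L[ℝ] P →L[ℝ] ℝ :=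
  combinePairings ε pairingField pairingDual

lemma pairingP_apply (ε : ℝ) (X Y : P) :
    pairingP ε X Y = ⟪fld (pot X), mom Y⟫ + ε * mu Y (dphi X) :=
  combinePairings_apply ε pairingField pairingDual X Y

lemma pairingM_invariant (R : SO3) (X Y : Minf) :
    pairingM (actM R X) (actM R Y) = pairingM X Y :=
  inner_push (rot R) _ _

lemma pairingP_invariant (ε : ℝ) (R : SO3) (X Y : P) :
    pairingP ε (actP R X) (actP R Y) = pairingP ε X Y := by
  have h1 : ⟪fld (pot (actP R X)), mom (actP R Y)⟫ = ⟪fld (pot X), mom Y⟫ :=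
    inner_push (rot R) (fld (pot X)) (mom Y)
  have h2 : mu (actP R Y) (dphi (actP R X)) = mu Y (dphi X) :=
    rotKdual_pairing R (mu Y) (dphi X)
  exact (pairingP_apply ε (actP R X) (actP R Y)).trans
    ((congrArg₂ (fun s t => s + ε * t) h1 h2).trans (pairingP_apply ε X Y).symm)

lemma isDenselyGenerated_actM : IsDenselyGenerated actM :=
  isDenselyGenerated_rotH1.prod isDenselyGenerated_rotHdiv0

lemma isDenselyGenerated_actP : IsDenselyGenerated actP :=
  isDenselyGenerated_rotH1div0.prod
    (isDenselyGenerated_rotK.prod (isDenselyGenerated_rotHdiv0.prod isDenselyGenerated_rotKdual))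

/-- The projection `P → M_∞` as a bounded operator. -/
noncomputable def toMinfL : P →L[ℝ] Minf := (potL + K.subtypeL.comp dphiL).prod momL

lemma toMinf_actP (R : SO3) (m : P) : toMinf (actP R m) = actM R (toMinf m) :=
  Prod.ext (map_add (rotH1 R) (pot m) (dphi m : H1)).symm rfl

lemma toMinfL_actP (R : SO3) (m : P) : toMinfL (actP R m) = actM R (toMinfL m) :=
  toMinf_actP R m

lemma potL_actP (R : SO3) (m : P) : potL (actP R m) = rotH1 R (potL m) := rfl

lemma dphiL_actP (R : SO3) (m : P) : dphiL (actP R m) = rotK R (dphiL m) := rfl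

lemma pot_mem_genDomain {m : P} (hm : m ∈ genDomain actP) : pot m ∈ genDomain rotH1 :=
  map_mem_genDomain potL potL_actP hm

lemma dphi_mem_genDomain {m : P} (hm : m ∈ genDomain actP) : dphi m ∈ genDomain rotK :=
  map_mem_genDomain dphiL dphiL_actP hm

lemma toMinf_mem_genDomain {m : P} (hm : m ∈ genDomain actP) : toMinf m ∈ genDomain actM :=
  map_mem_genDomain toMinfL toMinfL_actP hm

lemma coe_mem_genDomain {k : K} (hk : k ∈ genDomain rotK) : (k : H1) ∈ genDomain rotH1 :=
  map_mem_genDomain K.subtypeL (fun _ _ => rfl) hk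

lemma coe_fundField_rotK {k : K} (hk : k ∈ genDomain rotK) (ξ : so3) :
    ((fundField rotK ξ k : K) : H1) = fundField rotH1 ξ k :=
  (fundField_map K.subtypeL (fun _ _ => rfl) hk ξ).symm

lemma fst_mem_genDomain {m : Minf} (hm : m ∈ genDomain actM) : m.1 ∈ genDomain rotH1 :=
  (mem_genDomain_prod.1 hm).1

lemma fundField_actM_fst {m : Minf} (hm : m ∈ genDomain actM) (ξ : so3) :
    (fundField actM ξ m).1 = fundField rotH1 ξ m.1 :=
  congrArg Prod.fst (fundField_prod hm ξ)

lemma fundField_rotK_eq_sum {k : K} (hk : k ∈ genDomain rotK) (ξ : so3) :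
    fundField rotK ξ k = ∑ j, xiDual j ξ • fundField rotK (xi j) k := by
  apply Subtype.ext
  rw [coe_fundField_rotK hk, fundField_rotH1_eq_sum (coe_mem_genDomain hk)]
  simp only [Submodule.coe_sum, Submodule.coe_smul, coe_fundField_rotK hk]

lemma fld_fundField_rotK {k : K} (hk : k ∈ genDomain rotK) (j : Fin 3) :
    (fld ((fundField rotK (xi j) k : K) : H1) : E3 → E3) =ᵐ[volume] rotField j (k : H1) := by
  rw [coe_fundField_rotK hk]
  exact fld_fundField_xi (coe_mem_genDomain hk) j

lemma pairK_eq (μ : K →L[ℝ] ℝ) {k : K} {f : E3 → E3}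
    (h : (fld (k : H1) : E3 → E3) =ᵐ[volume] f) : pairK μ f = μ k := by
  have hex : ∃ k : K, (fld (k : H1) : E3 → E3) =ᵐ[volume] f := ⟨k, h⟩
  rw [pairK, dif_pos hex]
  congr 1
  exact Subtype.ext (fld_injective (Lp.ext (hex.choose_spec.trans h.symm)))

lemma sum_rotField_ae {a : H1} (ha : a ∈ genDomain rotH1) (j : Fin 3) (p : L2 E3) :
    (fun x => ∑ i, fld (fundField rotH1 (xi j) a) x i * p x i)
      =ᵐ[volume] fun x => ∑ i, rotField j a x i * p x i := by
  filter_upwards [fld_fundField_xi ha j] with x hx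
  rw [hx]

lemma integrable_rotField {a : H1} (ha : a ∈ genDomain rotH1) (j : Fin 3) (p : L2 E3) :
    Integrable fun x => ∑ i, rotField j a x i * p x i :=
  (integrable_sum_coord_mul _ _).congr (sum_rotField_ae ha j p)

lemma integral_rotField {a : H1} (ha : a ∈ genDomain rotH1) (j : Fin 3) (p : L2 E3) :
    ∫ x, ∑ i, rotField j a x i * p x i = ⟪fld (fundField rotH1 (xi j) a), p⟫ := by
  rw [← integral_sum_coord_mul, integral_congr_ae (sum_rotField_ae ha j p)]

/-- The angular momentum density of the field is the pairing of the infinitesimal rotation of the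
potential with the momentum. -/
lemma angularMomentumDensity_eq (j : Fin 3) (m : Minf) (x : E3) :
    angularMomentumDensity j m x = ∑ i, rotField j m.1 x i * (m.2 : L2 E3) x i := by
  fin_cases j <;>
    simp [angularMomentumDensity, angularMomentumTensor, momentumDensity, electric, rotField, orb,
      Fin.sum_univ_three] <;> ring

lemma integral_angularMomentumDensity {m : Minf} (hm : m.1 ∈ genDomain rotH1) (j : Fin 3) :
    ∫ x, angularMomentumDensity j m x = ⟪fld (fundField rotH1 (xi j) m.1), (m.2 : L2 E3)⟫ := by
  simp only [angularMomentumDensity_eq]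
  exact integral_rotField hm j _

lemma integrable_angularMomentumDensity {m : Minf} (hm : m.1 ∈ genDomain rotH1) (j : Fin 3) :
    Integrable (angularMomentumDensity j m) := by
  have e : angularMomentumDensity j m = fun x => ∑ i, rotField j m.1 x i * (m.2 : L2 E3) x i :=
    funext (angularMomentumDensity_eq j m)
  rw [e]
  exact integrable_rotField hm j _

lemma inner_fld_fundField_eq_sum {a : H1} (ha : a ∈ genDomain rotH1) (ξ : so3) (p : L2 E3) :
    ⟪fld (fundField rotH1 ξ a), p⟫
      = ∑ j, xiDual j ξ * ⟪fld (fundField rotH1 (xi j) a), p⟫ := by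
  rw [fundField_rotH1_eq_sum ha]
  simp only [← fldL_apply, map_sum, map_smul, sum_inner, real_inner_smul_left]

/-- The angular momentum is `⟨J(m), ξ⟩ = ∫ (X_ξ a) · p`. -/
lemma momentumM_apply {m : Minf} (hm : m ∈ genDomain actM) (ξ : so3) :
    momentumM m ξ = pairingM (fundField actM ξ m) m := by
  rw [pairingM_apply, fundField_actM_fst hm, inner_fld_fundField_eq_sum (fst_mem_genDomain hm)]
  simp only [momentumM, LinearMap.sum_apply, LinearMap.smul_apply, smul_eq_mul,
    integral_angularMomentumDensity (fst_mem_genDomain hm)]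
  exact Finset.sum_congr rfl fun j _ => mul_comm _ _

lemma current_eq (ε : ℝ) (j : Fin 3) {m : P} (hm : m ∈ genDomain actP) :
    current ε j m = ⟪fld (fundField rotH1 (xi j) (pot m)), mom m⟫
      + ε * mu m (fundField rotK (xi j) (dphi m)) := by
  rw [current, integral_rotField (pot_mem_genDomain hm),
    pairK_eq _ (fld_fundField_rotK (dphi_mem_genDomain hm) j)]

lemma momentumP_eq (ε : ℝ) {m : P} (hm : m ∈ genDomain actP) (ξ : so3) :
    momentumP ε m ξ = ⟪fld (fundField rotH1 ξ (pot m)), mom m⟫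
      + ε * mu m (fundField rotK ξ (dphi m)) := by
  rw [inner_fld_fundField_eq_sum (pot_mem_genDomain hm),
    fundField_rotK_eq_sum (dphi_mem_genDomain hm) ξ, map_sum, Finset.mul_sum,
    ← Finset.sum_add_distrib]
  simp only [momentumP, LinearMap.sum_apply, LinearMap.smul_apply, smul_eq_mul, current_eq ε _ hm,
    map_smul]
  exact Finset.sum_congr rfl fun j _ => by ring

lemma momentumP_apply (ε : ℝ) {m : P} (hm : m ∈ genDomain actP) (ξ : so3) :
    momentumP ε m ξ = pairingP ε (fundField actP ξ m) m := by
  have h1 : ⟪fld (fundField rotH1 ξ (pot m)), mom m⟫ = ⟪fld (pot (fundField actP ξ m)), mom m⟫ :=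
    congrArg (fun a => ⟪fld a, mom m⟫) (fundField_map potL potL_actP hm ξ)
  have h2 : mu m (fundField rotK ξ (dphi m)) = mu m (dphi (fundField actP ξ m)) :=
    congrArg (mu m) (fundField_map dphiL dphiL_actP hm ξ)
  exact (momentumP_eq ε hm ξ).trans ((congrArg₂ (fun s t => s + ε * t) h1 h2).trans
    (pairingP_apply ε (fundField actP ξ m) m).symm)

theorem isHamiltonianAction_actM : IsHamiltonianAction actM omegaM momentumM where
  map_one := isDenselyGenerated_actM.map_one
  map_mul := isDenselyGenerated_actM.map_mul
  continuous_orbit := isDenselyGenerated_actM.continuous_orbit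
  canonical R X Y := by
    rw [omegaM_eq, omegaM_eq, ← pairingM_apply, ← pairingM_apply, ← pairingM_apply,
      ← pairingM_apply, pairingM_invariant, pairingM_invariant]
  dense_domain := isDenselyGenerated_actM.dense_domain
  momentum := isMomentumMap_of_bilinear isDenselyGenerated_actM.map_one pairingM
    pairingM_invariant omegaM_eq fun _ hm ξ => momentumM_apply hm ξ

lemma omegaP_eq_pairingP (ε : ℝ) (X Y : P) :
    omegaP ε X Y = pairingP ε X Y - pairingP ε Y X := by
  refine (omegaP_eq ε X Y).trans (Eq.trans ?_
    (congrArg₂ (· - ·) (pairingP_apply ε X Y) (pairingP_apply ε Y X)).symm)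
  ring

theorem isHamiltonianAction_actP (ε : ℝ) :
    IsHamiltonianAction actP (omegaP ε) (momentumP ε) where
  map_one := isDenselyGenerated_actP.map_one
  map_mul := isDenselyGenerated_actP.map_mul
  continuous_orbit := isDenselyGenerated_actP.continuous_orbit
  canonical R X Y := (omegaP_eq_pairingP ε _ _).trans
    ((congrArg₂ (· - ·) (pairingP_invariant ε R X Y) (pairingP_invariant ε R Y X)).trans
      (omegaP_eq_pairingP ε X Y).symm)
  dense_domain := isDenselyGenerated_actP.dense_domain
  momentum := isMomentumMap_of_bilinear isDenselyGenerated_actP.map_one (pairingP ε)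
    (pairingP_invariant ε) (omegaP_eq_pairingP ε) fun _ hm ξ => momentumP_apply ε hm ξ

lemma momentumP_xi (ε : ℝ) (j : Fin 3) (m : P) : momentumP ε m (xi j) = current ε j m := by
  simp only [momentumP, LinearMap.sum_apply, LinearMap.smul_apply, smul_eq_mul, xiDual_xi]
  simp

/-! ### The geometry of the coisotropic extension -/

lemma inner_fld_K_mom (k : K) (p : Hdiv0) : ⟪fld (k : H1), (p : L2 E3)⟫ = 0 :=
  inner_fld_K k.2 p.2

/-- The kernel of the two-form of `M_∞` consists of the gradient directions. -/
lemma omegaM_kernel (X : Minf) : (∀ Y, omegaM X Y = 0) ↔ X.1 ∈ K ∧ X.2 = 0 := by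
  simp only [omegaM_eq]
  constructor
  · intro h
    have h2 : X.2 = 0 := by
      refine Subtype.ext (eq_zero_of_inner_fld fun a => ?_)
      have h0 := h (a, 0)
      have e : ((0 : Hdiv0) : L2 E3) = 0 := rfl
      rw [e, inner_zero_right] at h0
      linarith
    refine ⟨?_, h2⟩
    obtain ⟨k, hk, b, hb, hX⟩ := K.exists_add_mem_mem_orthogonal X.1
    rw [orthogonal_K] at hb
    have h0 : ⟪fld X.1, fld b⟫ - ⟪fld (0 : H1), (X.2 : L2 E3)⟫ = 0 :=
      h (0, ⟨fld b, mem_H1div0.1 hb⟩)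
    have e : fld X.1 = fld k + fld b := by rw [hX]; rfl
    have e' : fld (0 : H1) = 0 := rfl
    rw [e, e', inner_zero_left, inner_add_left, inner_fld_K hk (mem_H1div0.1 hb),
      zero_add, sub_zero,
      inner_self_eq_zero] at h0
    have hb0 : b = 0 := fld_injective h0
    rw [hX, hb0, add_zero]
    exact hk
  · rintro ⟨h1, h2⟩ Y
    have e : ((0 : Hdiv0) : L2 E3) = 0 := rfl
    rw [h2, e, inner_zero_right, sub_zero, inner_fld_K h1 Y.2.2]

lemma omegaP_nondegenerate {ε : ℝ} (hε : ε ≠ 0) (X : P) (h : ∀ Y, omegaP ε X Y = 0) : X = 0 := by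
  obtain ⟨a, k, p, μ⟩ := X
  have e0 : fld ((0 : H1div0) : H1) = 0 := rfl
  have e1 : ((0 : Hdiv0) : L2 E3) = 0 := rfl
  simp only [omegaP_eq, pot, dphi, mom, mu] at h
  -- `k` and `μ` are separated by the canonical form on `K × K*`
  have hk : k = 0 := by
    have h0 := h (0, 0, 0, innerSL ℝ k)
    have e2 : innerSL ℝ k k = ⟪k, k⟫ := rfl
    simp only [e0, e1, inner_zero_right, inner_zero_left, map_zero, sub_zero, zero_add, e2] at h0
    exact inner_self_eq_zero.1 ((mul_eq_zero.1 h0).resolve_left hε)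
  have hμ : μ = 0 := by
    ext l
    have h0 := h (0, l, 0, 0)
    simp only [e0, e1, inner_zero_right, inner_zero_left, zero_sub, sub_zero, zero_add,
      _root_.zero_apply] at h0
    have := (mul_eq_zero.1 h0).resolve_left hε
    simpa using this
  subst hk hμ
  -- `a` is tested against itself as a momentum, `p` against the divergence free part of all fields
  have ha : a = 0 := by
    have h0 := h (0, 0, ⟨fld (a : H1), a.2⟩, 0)
    simp only [e0, inner_zero_left, map_zero, sub_zero, mul_zero, add_zero,
      inner_self_eq_zero] at h0
    exact Subtype.ext (fld_injective h0)
  have hp : p = 0 := by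
    refine Subtype.ext (eq_zero_of_inner_fld fun b => ?_)
    obtain ⟨l, hl, c, hc, rfl⟩ := K.exists_add_mem_mem_orthogonal b
    rw [orthogonal_K] at hc
    have h0 := h (⟨c, hc⟩, 0, 0, 0)
    simp only [e1, inner_zero_right, map_zero, sub_zero, mul_zero, add_zero, zero_sub,
      neg_eq_zero] at h0
    have e : fld (l + c) = fld l + fld c := rfl
    rw [e, inner_add_left, inner_fld_K hl p.2, h0, add_zero]
  rw [ha, hp]; rfl

lemma existsUnique_toMinf (m : Minf) : ∃! n : P, mu n = 0 ∧ toMinf n = m := by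
  obtain ⟨u, v, huv, -⟩ := Submodule.existsUnique_add_of_isCompl isCompl_H1div0_K m.1
  refine ⟨(u, v, m.2, 0), ⟨rfl, Prod.ext huv rfl⟩, ?_⟩
  rintro ⟨a, k, p, μ⟩ ⟨h1, h2⟩
  have h3 : (a : H1) + (k : H1) = m.1 := congrArg Prod.fst h2
  have h4 : p = m.2 := congrArg Prod.snd h2
  obtain ⟨h5, h6⟩ : (a : H1) = u ∧ (k : H1) = v := by
    have h := Submodule.existsUnique_add_of_isCompl isCompl_H1div0_K m.1
    obtain ⟨u', v', -, hu⟩ := h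
    exact ⟨by rw [(hu a k h3).1, (hu u v huv).1], by rw [(hu a k h3).2, (hu u v huv).2]⟩
  have h7 : μ = 0 := h1
  rw [Subtype.ext h5, Subtype.ext h6, h4, h7]

lemma omegaP_restrict (ε : ℝ) (X Y : P) (hX : mu X = 0) (hY : mu Y = 0) :
    omegaP ε X Y = omegaM (toMinf X) (toMinf Y) := by
  rw [omegaP_eq, omegaM_eq, hX, hY]
  have e : ∀ Z : P, fld (toMinf Z).1 = fld (pot Z) + fld (dphi Z : H1) := fun Z => rfl
  have e1 : ((toMinf X).2 : L2 E3) = mom X := rfl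
  have e2 : ((toMinf Y).2 : L2 E3) = mom Y := rfl
  have k1 : ⟪fld (dphi X : H1), mom Y⟫ = 0 := inner_fld_K_mom _ _
  have k2 : ⟪fld (dphi Y : H1), mom X⟫ = 0 := inner_fld_K_mom _ _
  rw [e, e, e1, e2, inner_add_left, inner_add_left, k1, k2]
  simp

lemma coisotropic {ε : ℝ} (hε : ε ≠ 0) (X : P)
    (h : ∀ Y : P, mu Y = 0 → omegaP ε X Y = 0) : mu X = 0 := by
  ext l
  have h0 := h (0, l, 0, 0) rfl
  have e0 : fld ((0 : H1div0) : H1) = 0 := rfl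
  have e1 : ((0 : Hdiv0) : L2 E3) = 0 := rfl
  rw [omegaP_eq] at h0
  simp only [pot, dphi, mom, mu, e0, e1, inner_zero_right, inner_zero_left, zero_sub, sub_zero,
    zero_add, _root_.zero_apply] at h0
  have := (mul_eq_zero.1 h0).resolve_left hε
  simpa [mu] using this

lemma vertical_toMinf (X : P) : vertical isCompl_H1div0_K (toMinf X) = dphi X := by
  have e : (toMinf X).1 = pot X + (dphi X : H1) := rfl
  have h1 : Submodule.projectionOnto K H1div0 isCompl_H1div0_K.symm (pot X) = 0 :=
    (Submodule.projectionOnto_apply_eq_zero_iff _).2 X.1.2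
  rw [vertical, e, map_add, h1, zero_add, Submodule.projectionOnto_apply_left]

lemma toMinf_coulombUp (X : P) :
    toMinf (coulombUp X) = coulomb isCompl_H1div0_K (toMinf X) := by
  refine Prod.ext ?_ rfl
  have e1 : (toMinf (coulombUp X)).1 = pot X + ((0 : K) : H1) := rfl
  have e2 : (coulomb isCompl_H1div0_K (toMinf X)).1
      = pot X + (dphi X : H1) - (vertical isCompl_H1div0_K (toMinf X) : H1) := rfl
  rw [e1, e2, vertical_toMinf]
  simp

lemma vertical_fundField {m : P} (hm : m ∈ genDomain actP) (ξ : so3) :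
    vertical isCompl_H1div0_K (fundField actM ξ (toMinf m)) = fundField rotK ξ (dphi m) := by
  have h1 : fundField actM ξ (toMinf m) = toMinf (fundField actP ξ m) :=
    fundField_map toMinfL toMinfL_actP hm ξ
  rw [h1, vertical_toMinf]
  exact (fundField_map dphiL dphiL_actP hm ξ).symm

/-- The gradient part of the potential does not contribute to the angular momentum, its
infinitesimal rotation being a gradient. -/
lemma momentumM_toMinf {m : P} (hm : m ∈ genDomain actP) (ξ : so3) :
    momentumM (toMinf m) ξ = ⟪fld (fundField rotH1 ξ (pot m)), mom m⟫ := by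
  have hk := dphi_mem_genDomain hm
  rw [momentumM_apply (toMinf_mem_genDomain hm), pairingM_apply,
    fundField_actM_fst (toMinf_mem_genDomain hm)]
  have e : fundField rotH1 ξ (toMinf m).1
      = fundField rotH1 ξ (pot m) + ((fundField rotK ξ (dphi m) : K) : H1) := by
    rw [coe_fundField_rotK hk]
    exact fundField_add (pot_mem_genDomain hm) (coe_mem_genDomain hk) ξ
  have e' : fld (fundField rotH1 ξ (pot m) + ((fundField rotK ξ (dphi m) : K) : H1))
      = fld (fundField rotH1 ξ (pot m)) + fld ((fundField rotK ξ (dphi m) : K) : H1) := rfl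
  rw [e, e', inner_add_left, inner_fld_K_mom, add_zero]
  rfl

lemma momentumP_eq_abstract (ε : ℝ) {m : P} (hm : m ∈ genDomain actP) (ξ : so3) :
    momentumP ε m ξ = abstractMomentum isCompl_H1div0_K ε m ξ := by
  rw [abstractMomentum, momentumM_toMinf hm, vertical_fundField hm, momentumP_eq ε hm]

lemma momentumM_xi (m : Minf) (j : Fin 3) :
    momentumM m (xi j) = ∫ x, angularMomentumDensity j m x := by
  simp only [momentumM, LinearMap.sum_apply, LinearMap.smul_apply, smul_eq_mul, xiDual_xi]
  simp

end Momentum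

end Maxwell

theorem mainTheorem4 (ε : ℝ) (hε : ε = 1 ∨ ε = -1) :
    -- the splitting of `H¹(Σ)`; `K` is the characteristic distribution of `M_∞`
    ∃ h : IsCompl Maxwell.H1div0 Maxwell.K,
    (∀ X : Maxwell.Minf, (∀ Y, Maxwell.omegaM X Y = 0) ↔ X.1 ∈ Maxwell.K ∧ X.2 = 0) ∧
    -- `P` is symplectic and `M_∞ = {μ = 0}` is a coisotropic submanifold
    (∀ X : Maxwell.P, (∀ Y, Maxwell.omegaP ε X Y = 0) → X = 0) ∧
    (∀ m : Maxwell.Minf, ∃! n : Maxwell.P, Maxwell.mu n = 0 ∧ Maxwell.toMinf n = m) ∧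
    (∀ X Y : Maxwell.P, Maxwell.mu X = 0 → Maxwell.mu Y = 0 →
      Maxwell.omegaP ε X Y = Maxwell.omegaM (Maxwell.toMinf X) (Maxwell.toMinf Y)) ∧
    (∀ X : Maxwell.P, (∀ Y, Maxwell.mu Y = 0 → Maxwell.omegaP ε X Y = 0) → Maxwell.mu X = 0) ∧
    -- the action on `P` lifts the action on `M_∞`; both are Hamiltonian
    (∀ R m, Maxwell.toMinf (Maxwell.actP R m) = Maxwell.actM R (Maxwell.toMinf m)) ∧
    Maxwell.IsHamiltonianAction Maxwell.actM Maxwell.omegaM Maxwell.momentumM ∧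
    Maxwell.IsHamiltonianAction Maxwell.actP (Maxwell.omegaP ε) (Maxwell.momentumP ε) ∧
    -- the components of the momentum map are the explicit currents, whose terms make sense
    (∀ j m, Maxwell.momentumP ε m (Maxwell.xi j) = Maxwell.current ε j m) ∧
    (∀ m ∈ Maxwell.genDomain Maxwell.actP, ∀ j,
      Integrable (fun x => ∑ i : Fin 3,
        Maxwell.rotField j (Maxwell.pot m) x i * Maxwell.mom m x i) ∧
      ∃ k : Maxwell.K, (Maxwell.fld (k : Maxwell.H1) : Maxwell.E3 → Maxwell.E3) =ᵐ[volume]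
        Maxwell.rotField j (Maxwell.dphi m : Maxwell.H1)) ∧
    -- they coincide with the abstract formula for the extended Coulomb connection
    (∀ X : Maxwell.P, Maxwell.toMinf (Maxwell.coulombUp X)
        = Maxwell.coulomb h (Maxwell.toMinf X) ∧
      Maxwell.vertical h (Maxwell.toMinf X) = Maxwell.dphi (X - Maxwell.coulombUp X)) ∧
    (∀ m ∈ Maxwell.genDomain Maxwell.actP, ∀ ξ : Maxwell.so3,
      Maxwell.momentumP ε m ξ = Maxwell.abstractMomentum h ε m ξ) ∧
    -- on `μ = 0` they are the angular momentum charges of the electromagnetic field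
    (∀ m ∈ Maxwell.genDomain Maxwell.actP, Maxwell.mu m = 0 → ∀ j,
      Integrable (Maxwell.angularMomentumDensity j (Maxwell.toMinf m)) ∧
      Maxwell.current ε j m = ∫ x, Maxwell.angularMomentumDensity j (Maxwell.toMinf m) x) := by
  have hε0 : ε ≠ 0 := by rcases hε with rfl | rfl <;> norm_num
  refine ⟨Maxwell.isCompl_H1div0_K, Maxwell.omegaM_kernel, Maxwell.omegaP_nondegenerate hε0,
    Maxwell.existsUnique_toMinf, Maxwell.omegaP_restrict ε, Maxwell.coisotropic hε0,
    Maxwell.toMinf_actP, Maxwell.isHamiltonianAction_actM, Maxwell.isHamiltonianAction_actP ε,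
    Maxwell.momentumP_xi ε, fun m hm j => ⟨?_, ?_⟩, fun X => ⟨Maxwell.toMinf_coulombUp X, ?_⟩,
    fun m hm ξ => Maxwell.momentumP_eq_abstract ε hm ξ, fun m hm hμ j => ⟨?_, ?_⟩⟩
  · exact Maxwell.integrable_rotField (Maxwell.pot_mem_genDomain hm) j _
  · exact ⟨_, Maxwell.fld_fundField_rotK (Maxwell.dphi_mem_genDomain hm) j⟩
  · rw [Maxwell.vertical_toMinf]
    exact (sub_zero (Maxwell.dphi X)).symm
  · exact Maxwell.integrable_angularMomentumDensity
      (Maxwell.fst_mem_genDomain (Maxwell.toMinf_mem_genDomain hm)) j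
  · rw [← Maxwell.momentumM_xi, Maxwell.momentumM_toMinf hm, Maxwell.current_eq ε j hm, hμ]
    simp
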